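/- **Type theories.** By a type theory we mean a formal system deriving statements $\mathcal J\,[\Gamma]$, where $\Gamma=[x_0\in A_0,\dots,x_{n-1}\in A_{n-1}(x_0,\dots,x_{n-2})]$ is a (finite, possibly empty) context and $\mathcal J$ is a judgement of one of the forms $A\in\mathrm{Type}$, $a\in A$, $A=B\in\mathrm{Type}$, $a=b\in A$. The system contains the basic structural rules of dependent type theory (variables, weakening, substitution, reflexivity, symmetry and transitivity of definitional equality of types and of terms, conversion of $a\in A$ and of $a=b\in A$ along $A=B$), definitional equality is respected by all type and term constructors, the system may contain arbitrary further constructors and rules, and $\mathcal J\,[\Gamma]$ is derivable only if each $A_i\in\mathrm{Type}\,[x_0\in A_0,\dots,x_{i-1}\in A_{i-1}]$ is derivable. It has *strong sums* if it has a type $1$ with $*\in1$ and $a=*\in 1$ for all $a\in1$, and a type constructor $\Sigma x\in A.B$ (for $A\in\mathrm{Type}$, $B\in\mathrm{Type}\,[x\in A]$) with pairing $\mathbf p ab\in\Sigma x\in A.B$ (for $a\in A$, $b\in B[a/x]$), projections $\mathbf p_0c\in A$, $\mathbf p_1c\in B[\mathbf p_0c/x]$ (for $c\in \Sigma x\in A.B$)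 and definitional equalities $\mathbf p_0(\mathbf pab)=a$, $\mathbf p_1(\mathbf pab)=b$, $\mathbf p(\mathbf p_0c)(\mathbf p_1c)=c$. It has *propositional identity types* if it has formers $\mathrm{Id},\mathbf r,\mathbf J,\mathbf H$ such that * $\mathrm{Id}_A(a,b)\in\mathrm{Type}$ for $a,b\in A$, and $\mathbf r(a)\in\mathrm{Id}_A(a,a)$ for $a\in A$; * if $C(x,y,u)\in\mathrm{Type}\,[x\in A,y\in A,u\in\mathrm{Id}_A(x,y),\Delta(x,y,u)]$, $p\in\mathrm{Id}_A(a,b)$ and $d(x)\in C(x,x,\mathbf r(x))\,[x\in A,\Delta(x,x,\mathbf r(x))]$, then $\mathbf J(a,b,p,d)\in C(a,b,p)\,[\Delta(a,b,p)]$; * if $C$ and $d$ are as before and $a\in A$, then $\mathbf H(a,d)\in\mathrm{Id}_{C(a,a,\mathbf r(a))}(\mathbf J(a,a,\mathbf r(a),d),d(a))\,[\Delta(a,a,\mathbf r(a))]$. All these rules are meant in an arbitrary ambient context; all formers commute with substitution and respect definitional equality. **Classifying category.** Its objects are the well-formed contexts, two contexts of the same length being identified if their types are definitionally equal one after the other;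 a morphism $\Delta\to\Gamma$ is a tuple of terms $t_i\in A_i(t_0,\dots,t_{i-1})\,[\Delta]$ up to definitional equality; composition is substitution. A *dependent projection* is a projection $[\Gamma,\Delta]\to\Gamma$ that drops a final segment of a context; a *fibration* is a morphism isomorphic to a dependent projection. **Tribes.** A *tribe* is a category with a terminal object and a class of morphisms, called fibrations, which contains all isomorphisms and all morphisms $X\to1$, is closed under composition, and is such that for every fibration $p:X'\to X$ and every $f:Y\to X$ there is a pullback of $p$ along $f$ that is again a fibration $Y'\to Y$. A tribe has *propositional identity types* if one can choose for every fibration $\alpha:A\to I$ a factorisation of the diagonal $A\to A\times_IA$ as a map $r:A\to P_IA$ followed by a fibration $(s,t):P_IA\to A\times_IA$ such that: 1. if $g:V\to U$ is any pullback of $r:A\to P_IA$ along a fibration $U\to P_IA$, and $f:B\to D$ is a fibration, $k:V\to B$, $l:U\to D$ with $fk=lg$, then there are $d:U\to B$ and $H:V\to P_D(B)$ with $fd=l$, $sH=dg$ and $tH=k$; 2. for every fibration $\alpha : A\to I$ and every map $\kappa:J\to I$ there are morphisms $P_J(\kappa^*A)\to\kappa^*(P_IA)$ and $\kappa^*(P_IA)\to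 P_J(\kappa^*A)$ over $\kappa^*(A\times_IA)\cong\kappa^*A\times_J\kappa^*A$. **Proposition.** The classifying category of any type theory with strong sums and propositional identity types, with the fibrations above, is a tribe with propositional identity types. -/

import Mathlib

open CategoryTheory CategoryTheory.Limits

universe u

namespace DTT

/-! ### Raw expressions

Raw types and terms are well-scoped: `Expr S .ty n` and `Expr S .tm n` are the raw types and terms
whose free variables are among `n` given ones. Variables are de Bruijn indices, so the variable
`0` is the one declared last. -/

/-- The two kinds of raw expressions: types and terms. -/
inductive Srt : Type
  | ty
  | tm

/-- `S.Op s [(s₁, b₁), …, (sₖ, bₖ)]` is the set of primitive constructors that build an expression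
of sort `s` from `k` arguments, where the `i`-th argument has sort `sᵢ` and binds `bᵢ` variables. -/
structure Signature where
  Op : Srt → List (Srt × ℕ) → Type u

/-- `ext n k = n + k`, computed so that `ext n (k + 1)` unfolds to `ext (n + 1) k`. -/
@[reducible]
def ext : ℕ → ℕ → ℕ
  | n, 0 => n
  | n, k + 1 => ext (n + 1) k

inductive Expr (S : Signature.{u}) : Srt → ℕ → Type u
  | var {n : ℕ} (i : Fin n) : Expr S Srt.tm n
  | op {s : Srt} {n : ℕ} {ar : List (Srt × ℕ)} (o : S.Op s ar)
      (args : ∀ i : Fin ar.length, Expr S (ar.get i).1 (ext n (ar.get i).2)) : Expr S s n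

abbrev Ty (S : Signature.{u}) (n : ℕ) : Type u := Expr S Srt.ty n

abbrev Tm (S : Signature.{u}) (n : ℕ) : Type u := Expr S Srt.tm n

/-- Simultaneous substitutions: an `n`-tuple of terms with free variables among `m` given ones. -/
abbrev Sub (S : Signature.{u}) (n m : ℕ) : Type u := Fin n → Tm S m

section Substitution

variable {S : Signature.{u}} {s : Srt} {n m l : ℕ}

/-- A renaming extended by one bound variable. -/
def upRen (ρ : Fin n → Fin m) : Fin (n + 1) → Fin (m + 1) :=
  Fin.cases 0 (fun i => (ρ i).succ)

/-- A renaming extended by `k` bound variables. -/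
def upRenN : {n m : ℕ} → (k : ℕ) → (Fin n → Fin m) → Fin (ext n k) → Fin (ext m k)
  | _, _, 0, ρ => ρ
  | _, _, k + 1, ρ => upRenN k (upRen ρ)

def Expr.ren : {s : Srt} → {n m : ℕ} → Expr S s n → (Fin n → Fin m) → Expr S s m
  | _, _, _, Expr.var i, ρ => Expr.var (ρ i)
  | _, _, _, Expr.op o args, ρ => Expr.op o (fun i => (args i).ren (upRenN _ ρ))

/-- Weakening of an expression by one new last variable. -/
def Expr.wk (e : Expr S s n) : Expr S s (n + 1) := e.ren Fin.succ

/-- The substitution that maps the last variable to `t` and the others according to `σ`. -/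
def Sub.cons (t : Tm S m) (σ : Sub S n m) : Sub S (n + 1) m := Fin.cases t σ

/-- The identity substitution. -/
def Sub.id (n : ℕ) : Sub S n n := Expr.var

/-- A substitution extended by one bound variable. -/
def Sub.up (σ : Sub S n m) : Sub S (n + 1) (m + 1) :=
  Sub.cons (Expr.var 0) (fun i => (σ i).wk)

/-- A substitution extended by `k` bound variables. -/
def Sub.upN : {n m : ℕ} → (k : ℕ) → Sub S n m → Sub S (ext n k) (ext m k)
  | _, _, 0, σ => σ
  | _, _, k + 1, σ => Sub.upN k (Sub.up σ)

/-- Capture-avoiding simultaneous substitution. -/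
def Expr.sub : {s : Srt} → {n m : ℕ} → Expr S s n → Sub S n m → Expr S s m
  | _, _, _, Expr.var i, σ => σ i
  | _, _, _, Expr.op o args, σ => Expr.op o (fun i => (args i).sub (Sub.upN _ σ))

/-- The substitution `[a/x]` of `a` for the last variable `x`. -/
def Sub.inst (a : Tm S n) : Sub S (n + 1) n := Sub.cons a (Sub.id n)

/-- Composition of substitutions: `(σ ⬝ τ) i = (σ i)[τ]`. -/
def Sub.comp (σ : Sub S n m) (τ : Sub S m l) : Sub S n l := fun i => (σ i).sub τ

/-! Basic facts on substitution. -/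

theorem up_ren_id : upRen (fun i : Fin n => i) = fun i => i := by
  funext i; refine Fin.cases rfl (fun _ => rfl) i

theorem upN_ren_var (k : ℕ) : ∀ {n m : ℕ} (ρ : Fin n → Fin m),
    Sub.upN k (fun i => (Expr.var (ρ i) : Tm S m)) = fun i => Expr.var (upRenN k ρ i) := by
  induction k with
  | zero => intros; rfl
  | succ k ih =>
    intro n m ρ
    have h : Sub.up (fun i => (Expr.var (ρ i) : Tm S m)) = fun i => Expr.var (upRen ρ i) := by
      funext i; refine Fin.cases rfl (fun _ => rfl) i
    change Sub.upN k (Sub.up _) = _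
    rw [h, ih]; rfl

theorem Expr.ren_eq_sub (e : Expr S s n) : ∀ {m : ℕ} (ρ : Fin n → Fin m),
    e.ren ρ = e.sub (fun i => Expr.var (ρ i)) := by
  induction e with
  | var i => intros; rfl
  | op o args ih =>
    intro m ρ
    simp only [Expr.ren, Expr.sub, upN_ren_var]
    congr 1; funext i; exact ih i _

theorem upN_id (k : ℕ) : ∀ {n : ℕ}, Sub.upN k (Sub.id (S := S) n) = Sub.id (ext n k) := by
  induction k with
  | zero => intros; rfl
  | succ k ih =>
    intro n
    have h : Sub.up (Sub.id (S := S) n) = Sub.id (n + 1) := by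
      funext i; refine Fin.cases rfl (fun _ => rfl) i
    change Sub.upN k (Sub.up _) = _
    rw [h, ih]

theorem Expr.sub_id (e : Expr S s n) : e.sub (Sub.id n) = e := by
  induction e with
  | var i => rfl
  | op o args ih =>
    simp only [Expr.sub, upN_id]
    congr 1; funext i; exact ih i

theorem upN_ren_comp (k : ℕ) : ∀ {n m l : ℕ} (ρ : Fin n → Fin m) (σ : Sub S m l),
    (fun i => Sub.upN k σ (upRenN k ρ i)) = Sub.upN k (fun i => σ (ρ i)) := by
  induction k with
  | zero => intros; rfl
  | succ k ih =>
    intro n m l ρ σ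
    change (fun i => Sub.upN k (Sub.up σ) (upRenN k (upRen ρ) i)) = Sub.upN k (Sub.up _)
    rw [ih]; congr 1; funext i; refine Fin.cases rfl (fun _ => rfl) i

theorem Expr.ren_sub (e : Expr S s n) : ∀ {m l : ℕ} (ρ : Fin n → Fin m) (σ : Sub S m l),
    (e.ren ρ).sub σ = e.sub (fun i => σ (ρ i)) := by
  induction e with
  | var i => intros; rfl
  | op o args ih =>
    intro m l ρ σ
    simp only [Expr.ren, Expr.sub]
    congr 1; funext i; rw [ih, upN_ren_comp]

theorem Expr.wk_ren (e : Expr S s n) (ρ : Fin n → Fin m) : (e.ren ρ).wk = e.wk.ren (upRen ρ) := by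
  simp only [Expr.wk]
  rw [Expr.ren_eq_sub (e.ren ρ), Expr.ren_sub, Expr.ren_eq_sub (e.ren _), Expr.ren_sub]
  rfl

theorem upN_sub_ren (k : ℕ) : ∀ {n m l : ℕ} (σ : Sub S n m) (ρ : Fin m → Fin l),
    (fun i => (Sub.upN k σ i).ren (upRenN k ρ)) = Sub.upN k (fun i => (σ i).ren ρ) := by
  induction k with
  | zero => intros; rfl
  | succ k ih =>
    intro n m l σ ρ
    change (fun i => (Sub.upN k (Sub.up σ) i).ren (upRenN k (upRen ρ))) = Sub.upN k (Sub.up _)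
    rw [ih]; congr 1; funext i
    refine Fin.cases rfl (fun j => ?_) i
    exact (Expr.wk_ren (σ j) ρ).symm

theorem Expr.sub_ren (e : Expr S s n) : ∀ {m l : ℕ} (σ : Sub S n m) (ρ : Fin m → Fin l),
    (e.sub σ).ren ρ = e.sub (fun i => (σ i).ren ρ) := by
  induction e with
  | var i => intros; rfl
  | op o args ih =>
    intro m l σ ρ
    simp only [Expr.ren, Expr.sub]
    congr 1; funext i; rw [ih, upN_sub_ren]

theorem Expr.wk_sub (e : Expr S s n) (σ : Sub S (n + 1) m) :
    e.wk.sub σ = e.sub (fun i => σ i.succ) := Expr.ren_sub e _ _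

theorem Expr.wk_sub_cons (e : Expr S s n) (t : Tm S m) (σ : Sub S n m) :
    e.wk.sub (Sub.cons t σ) = e.sub σ := Expr.wk_sub e _

theorem Expr.sub_wk (e : Expr S s n) (σ : Sub S n m) : (e.sub σ).wk = e.wk.sub (Sub.up σ) := by
  rw [Expr.wk_sub]; exact Expr.sub_ren e _ _

theorem upN_comp (k : ℕ) : ∀ {n m l : ℕ} (σ : Sub S n m) (τ : Sub S m l),
    Sub.comp (Sub.upN k σ) (Sub.upN k τ) = Sub.upN k (Sub.comp σ τ) := by
  induction k with
  | zero => intros; rfl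
  | succ k ih =>
    intro n m l σ τ
    change Sub.comp (Sub.upN k (Sub.up σ)) (Sub.upN k (Sub.up τ)) = Sub.upN k (Sub.up _)
    rw [ih]; congr 1; funext i
    refine Fin.cases rfl (fun j => ?_) i
    exact (Expr.sub_wk (σ j) τ).symm

theorem Expr.sub_sub (e : Expr S s n) : ∀ {m l : ℕ} (σ : Sub S n m) (τ : Sub S m l),
    (e.sub σ).sub τ = e.sub (Sub.comp σ τ) := by
  induction e with
  | var i => intros; rfl
  | op o args ih =>
    intro m l σ τ
    simp only [Expr.sub]
    congr 1; funext i; rw [ih, upN_comp]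

theorem Sub.up_comp_inst (σ : Sub S n m) (t : Tm S m) :
    Sub.comp (Sub.up σ) (Sub.inst t) = Sub.cons t σ := by
  funext i
  refine Fin.cases rfl (fun j => ?_) i
  change ((σ j).wk).sub (Sub.cons t (Sub.id m)) = σ j
  rw [Expr.wk_sub_cons, Expr.sub_id]

theorem Sub.cons_eta (σ : Sub S (n + 1) m) : Sub.cons (σ 0) (fun i => σ i.succ) = σ := by
  funext i; refine Fin.cases rfl (fun _ => rfl) i

end Substitution

/-! ### Contexts, judgements and derivability -/

/-- Raw contexts `[x₀ ∈ A₀, …, xₙ₋₁ ∈ Aₙ₋₁(x₀, …, xₙ₋₂)]` of length `n`. -/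
inductive Ctx (S : Signature.{u}) : ℕ → Type u
  | nil : Ctx S 0
  | snoc {n : ℕ} (Γ : Ctx S n) (A : Ty S n) : Ctx S (n + 1)

/-- Raw context extensions of length `k` of a context of length `n`. -/
inductive Tel (S : Signature.{u}) : ℕ → ℕ → Type u
  | nil {n : ℕ} : Tel S n 0
  | cons {n k : ℕ} (A : Ty S n) (Θ : Tel S (n + 1) k) : Tel S n (k + 1)

/-- Judgements with free variables among `n` given ones, in order: `A ∈ Type`, `a ∈ A`,
`A = B ∈ Type`, `a = b ∈ A`. -/
inductive Judg (S : Signature.{u}) (n : ℕ) : Type u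
  | isTy (A : Ty S n) : Judg S n
  | hasTy (a : Tm S n) (A : Ty S n) : Judg S n
  | eqTy (A B : Ty S n) : Judg S n
  | eqTm (a b : Tm S n) (A : Ty S n) : Judg S n

section Contexts

variable {S : Signature.{u}}

/-- The context `[Γ, Θ]`. -/
def Ctx.append : {n k : ℕ} → Ctx S n → Tel S n k → Ctx S (ext n k)
  | _, _, Γ, Tel.nil => Γ
  | n, _, Γ, Tel.cons A Θ => Ctx.append (n := n + 1) (Γ.snoc A) Θ

def Tel.sub : {n m k : ℕ} → Tel S n k → Sub S n m → Tel S m k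
  | _, _, _, Tel.nil, _ => Tel.nil
  | _, _, _, Tel.cons A Θ, σ => Tel.cons (A.sub σ) (Θ.sub (Sub.up σ))

def Judg.sub {n m : ℕ} : Judg S n → Sub S n m → Judg S m
  | Judg.isTy A, σ => Judg.isTy (A.sub σ)
  | Judg.hasTy a A, σ => Judg.hasTy (a.sub σ) (A.sub σ)
  | Judg.eqTy A B, σ => Judg.eqTy (A.sub σ) (B.sub σ)
  | Judg.eqTm a b A, σ => Judg.eqTm (a.sub σ) (b.sub σ) (A.sub σ)

/-- The type of the `i`-th variable of `Γ`, as a type over all variables of `Γ`. -/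
def Ctx.type : {n : ℕ} → Ctx S n → Fin n → Ty S n
  | _, Ctx.nil => Fin.elim0
  | _, Ctx.snoc Γ A => Fin.cases A.wk (fun i => (Γ.type i).wk)

/-- The substitution that forgets the last variable. -/
def Sub.proj (n : ℕ) : Sub S n (n + 1) := fun i => Expr.var i.succ

theorem Tel.sub_sub : ∀ {n k : ℕ} (Θ : Tel S n k) {m l : ℕ} (σ : Sub S n m) (τ : Sub S m l),
    (Θ.sub σ).sub τ = Θ.sub (Sub.comp σ τ) := by
  intro n k Θ
  induction Θ with
  | nil => intros; rfl
  | cons A Θ ih =>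
    intro m l σ τ
    simp only [Tel.sub, Expr.sub_sub, ih]
    congr 2
    exact upN_comp 1 σ τ

theorem Tel.sub_id : ∀ {n k : ℕ} (Θ : Tel S n k), Θ.sub (Sub.id n) = Θ := by
  intro n k Θ
  induction Θ with
  | nil => rfl
  | @cons n k A Θ ih =>
    have h : Sub.up (Sub.id (S := S) n) = Sub.id (n + 1) := upN_id 1
    simp only [Tel.sub, Expr.sub_id, h, ih]

theorem Judg.sub_sub {n m l : ℕ} (J : Judg S n) (σ : Sub S n m) (τ : Sub S m l) :
    (J.sub σ).sub τ = J.sub (Sub.comp σ τ) := by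
  cases J <;> simp only [Judg.sub, Expr.sub_sub]

theorem Judg.sub_id {n : ℕ} (J : Judg S n) : J.sub (Sub.id n) = J := by
  cases J <;> simp only [Judg.sub, Expr.sub_id]

end Contexts

/-- A statement `𝒥 [Γ]`. -/
structure Stmt (S : Signature.{u}) where
  len : ℕ
  ctx : Ctx S len
  judg : Judg S len

/-- Derivability in the formal system whose rules are those in `R` (each given by its finitely many
premises and its conclusion) and the basic rules of dependent type theory. The last two rules say
that types and terms respect definitional equality; they sum up the congruence rules for all type
and term constructors. -/
inductive Derivable {S : Signature.{u}} (R : Set (List (Stmt S) × Stmt S)) :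
    {n : ℕ} → Ctx S n → Judg S n → Prop
  | rule {ps : List (Stmt S)} {c : Stmt S} (h : (ps, c) ∈ R)
      (hps : ∀ p ∈ ps, Derivable R p.ctx p.judg) : Derivable R c.ctx c.judg
  | ax {n : ℕ} {Δ : Ctx S n} {A : Ty S n} (hA : Derivable R Δ (.isTy A)) :
      Derivable R (Δ.snoc A) (.hasTy (.var 0) A.wk)
  | weakening {n k : ℕ} {Δ : Ctx S n} {Γ : Tel S n k} {J : Judg S (ext n k)} {A : Ty S n}
      (hJ : Derivable R (Δ.append Γ) J) (hA : Derivable R Δ (.isTy A)) :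
      Derivable R ((Δ.snoc A).append (Γ.sub (Sub.proj n))) (J.sub (Sub.upN k (Sub.proj n)))
  | substitution {n k : ℕ} {Δ : Ctx S n} {A : Ty S n} {Γ : Tel S (n + 1) k}
      {J : Judg S (ext (n + 1) k)} {a : Tm S n}
      (hJ : Derivable R ((Δ.snoc A).append Γ) J) (ha : Derivable R Δ (.hasTy a A)) :
      Derivable R (Δ.append (Γ.sub (Sub.inst a))) (J.sub (Sub.upN k (Sub.inst a)))
  | ty_refl {n : ℕ} {Γ : Ctx S n} {A : Ty S n} (hA : Derivable R Γ (.isTy A)) :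
      Derivable R Γ (.eqTy A A)
  | ty_symm {n : ℕ} {Γ : Ctx S n} {A B : Ty S n} (h : Derivable R Γ (.eqTy A B)) :
      Derivable R Γ (.eqTy B A)
  | ty_trans {n : ℕ} {Γ : Ctx S n} {A B C : Ty S n} (h : Derivable R Γ (.eqTy A B))
      (h' : Derivable R Γ (.eqTy B C)) : Derivable R Γ (.eqTy A C)
  | tm_refl {n : ℕ} {Γ : Ctx S n} {a : Tm S n} {A : Ty S n} (ha : Derivable R Γ (.hasTy a A)) :
      Derivable R Γ (.eqTm a a A)
  | tm_symm {n : ℕ} {Γ : Ctx S n} {a b : Tm S n} {A : Ty S n}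
      (h : Derivable R Γ (.eqTm a b A)) : Derivable R Γ (.eqTm b a A)
  | tm_trans {n : ℕ} {Γ : Ctx S n} {a b c : Tm S n} {A : Ty S n}
      (h : Derivable R Γ (.eqTm a b A)) (h' : Derivable R Γ (.eqTm b c A)) :
      Derivable R Γ (.eqTm a c A)
  | tm_conv {n : ℕ} {Γ : Ctx S n} {a : Tm S n} {A B : Ty S n} (ha : Derivable R Γ (.hasTy a A))
      (h : Derivable R Γ (.eqTy A B)) : Derivable R Γ (.hasTy a B)
  | eq_conv {n : ℕ} {Γ : Ctx S n} {a b : Tm S n} {A B : Ty S n}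
      (hab : Derivable R Γ (.eqTm a b A)) (h : Derivable R Γ (.eqTy A B)) :
      Derivable R Γ (.eqTm a b B)
  | ty_congr {n m : ℕ} {Γ : Ctx S n} {Δ : Ctx S m} {A : Ty S n} {σ τ : Sub S n m}
      (hA : Derivable R Γ (.isTy A)) (hAσ : Derivable R Δ (.isTy (A.sub σ)))
      (hσ : ∀ i, Derivable R Δ (.hasTy (σ i) ((Γ.type i).sub σ)))
      (hτ : ∀ i, Derivable R Δ (.hasTy (τ i) ((Γ.type i).sub τ)))
      (h : ∀ i, Derivable R Δ (.eqTm (σ i) (τ i) ((Γ.type i).sub σ))) :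
      Derivable R Δ (.eqTy (A.sub σ) (A.sub τ))
  | tm_congr {n m : ℕ} {Γ : Ctx S n} {Δ : Ctx S m} {a : Tm S n} {A : Ty S n} {σ τ : Sub S n m}
      (ha : Derivable R Γ (.hasTy a A)) (haσ : Derivable R Δ (.hasTy (a.sub σ) (A.sub σ)))
      (hσ : ∀ i, Derivable R Δ (.hasTy (σ i) ((Γ.type i).sub σ)))
      (hτ : ∀ i, Derivable R Δ (.hasTy (τ i) ((Γ.type i).sub τ)))
      (h : ∀ i, Derivable R Δ (.eqTm (σ i) (τ i) ((Γ.type i).sub σ))) :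
      Derivable R Δ (.eqTm (a.sub σ) (a.sub τ) (A.sub σ))

/-- Well-formed contexts: each type is derivable in the context that precedes it. -/
inductive WfCtx {S : Signature.{u}} (R : Set (List (Stmt S) × Stmt S)) :
    {n : ℕ} → Ctx S n → Prop
  | nil : WfCtx R Ctx.nil
  | snoc {n : ℕ} {Γ : Ctx S n} {A : Ty S n} (hΓ : WfCtx R Γ) (hA : Derivable R Γ (.isTy A)) :
      WfCtx R (Γ.snoc A)

/-- A dependent type theory: a signature of type and term constructors and a set of rules, such
that statements are derivable in well-formed contexts only. -/
structure TypeTheory where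
  sig : Signature.{u}
  rules : Set (List (Stmt sig) × Stmt sig)
  ctx_wf : ∀ {n : ℕ} {Γ : Ctx sig n} {J : Judg sig n}, Derivable rules Γ J → WfCtx rules Γ

namespace TypeTheory

variable (T : TypeTheory.{u})

/-- `T.Der Γ J`: the statement `J [Γ]` is derivable in `T`. -/
abbrev Der {n : ℕ} (Γ : Ctx T.sig n) (J : Judg T.sig n) : Prop := Derivable T.rules Γ J

/-- `T.Wf Γ`: the context `Γ` is well-formed in `T`. -/
abbrev Wf {n : ℕ} (Γ : Ctx T.sig n) : Prop := WfCtx T.rules Γ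

/-! ### The classifying category -/

/-- `σ : Δ → Γ` is a context morphism: `σ i ∈ Aᵢ(σ) [Δ]` is derivable for every variable
`xᵢ ∈ Aᵢ` of `Γ`. -/
def IsSub {m n : ℕ} (Δ : Ctx T.sig m) (Γ : Ctx T.sig n) (σ : Sub T.sig n m) : Prop :=
  ∀ i, T.Der Δ (.hasTy (σ i) ((Γ.type i).sub σ))

/-- Definitional equality of context morphisms `σ, τ : Δ → Γ`. -/
def EqSub {m n : ℕ} (Δ : Ctx T.sig m) (Γ : Ctx T.sig n) (σ τ : Sub T.sig n m) : Prop :=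
  ∀ i, T.Der Δ (.eqTm (σ i) (τ i) ((Γ.type i).sub σ))

/-- Definitional equality of contexts of the same length. -/
def EqCtx : {n : ℕ} → Ctx T.sig n → Ctx T.sig n → Prop
  | _, Ctx.nil, Ctx.nil => True
  | _, Ctx.snoc Γ A, Ctx.snoc Γ' A' => EqCtx Γ Γ' ∧ T.Der Γ (.eqTy A A')

section Lemmas

variable {T} {m n l : ℕ}

theorem isSub_snoc {Δ : Ctx T.sig m} {Γ : Ctx T.sig n} {A : Ty T.sig n} {σ : Sub T.sig (n + 1) m} :
    T.IsSub Δ (Γ.snoc A) σ ↔ T.IsSub Δ Γ (fun i => σ i.succ) ∧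
      T.Der Δ (.hasTy (σ 0) (A.sub (fun i => σ i.succ))) := by
  constructor
  · intro h
    refine ⟨fun i => ?_, ?_⟩
    · have := h i.succ
      rwa [show (Γ.snoc A).type i.succ = (Γ.type i).wk from rfl, Expr.wk_sub] at this
    · have := h 0
      rwa [show (Γ.snoc A).type 0 = A.wk from rfl, Expr.wk_sub] at this
  · rintro ⟨h, h0⟩ i
    refine Fin.cases ?_ (fun j => ?_) i
    · rwa [show (Γ.snoc A).type 0 = A.wk from rfl, Expr.wk_sub]
    · rw [show (Γ.snoc A).type j.succ = (Γ.type j).wk from rfl, Expr.wk_sub]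
      exact h j

/-- Simultaneous substitution under a context extension is admissible. -/
theorem der_sub_tel {Δ : Ctx T.sig m} (hΔ : T.Wf Δ) (Γ : Ctx T.sig n) :
    ∀ {k : ℕ} (Θ : Tel T.sig n k) (J : Judg T.sig (ext n k)) (σ : Sub T.sig n m),
      T.IsSub Δ Γ σ → T.Der (Γ.append Θ) J →
      T.Der (Δ.append (Θ.sub σ)) (J.sub (Sub.upN k σ)) := by
  induction Γ with
  | nil =>
    intro k Θ J σ _ hJ
    induction hΔ with
    | nil =>
      have : σ = Sub.id 0 := funext fun i => i.elim0
      subst this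
      rwa [Tel.sub_id, upN_id, Judg.sub_id]
    | @snoc m Δ B hΔ hB ih =>
      have h := Derivable.weakening (ih (fun i => i.elim0) (fun i => i.elim0)) hB
      rw [Tel.sub_sub, Judg.sub_sub, upN_comp] at h
      have e : Sub.comp (fun i : Fin 0 => (i.elim0 : Tm T.sig m)) (Sub.proj m) = σ :=
        funext fun i => i.elim0
      rwa [e] at h
  | @snoc n Γ A ih =>
    intro k Θ J σ hσ hJ
    rw [isSub_snoc] at hσ
    have h := ih (Tel.cons A Θ) J _ hσ.1 hJ
    have h2 := Derivable.substitution (k := k) h hσ.2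
    have e : Sub.comp (Sub.up fun i => σ i.succ) (Sub.inst (σ 0)) = σ := by
      rw [Sub.up_comp_inst, Sub.cons_eta]
    rw [Tel.sub_sub, Judg.sub_sub, e] at h2
    change T.Der _ (J.sub (Sub.comp (Sub.upN k (Sub.up _)) _)) at h2
    rwa [upN_comp, e] at h2

theorem der_sub {Δ : Ctx T.sig m} (hΔ : T.Wf Δ) {Γ : Ctx T.sig n} {J : Judg T.sig n}
    {σ : Sub T.sig n m} (hσ : T.IsSub Δ Γ σ) (hJ : T.Der Γ J) : T.Der Δ (J.sub σ) :=
  der_sub_tel hΔ Γ Tel.nil J σ hσ hJ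

theorem der_wk {Δ : Ctx T.sig m} {A : Ty T.sig m} {J : Judg T.sig m} (hJ : T.Der Δ J)
    (hA : T.Der Δ (.isTy A)) : T.Der (Δ.snoc A) (J.sub (Sub.proj m)) :=
  Derivable.weakening (Γ := Tel.nil) hJ hA

theorem wk_eq_sub {s : Srt} (e : Expr T.sig s n) : e.wk = e.sub (Sub.proj n) :=
  Expr.ren_eq_sub e _

theorem isSub_wk {Δ : Ctx T.sig m} {A : Ty T.sig m} {Γ : Ctx T.sig n} {σ : Sub T.sig n m}
    (hσ : T.IsSub Δ Γ σ) (hA : T.Der Δ (.isTy A)) :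
    T.IsSub (Δ.snoc A) Γ (fun i => (σ i).wk) := by
  intro i
  have h := der_wk (hσ i) hA
  simp only [Judg.sub, ← wk_eq_sub] at h
  rwa [Expr.sub_wk, Expr.wk_sub] at h

theorem isSub_up {Δ : Ctx T.sig m} {A : Ty T.sig n} {Γ : Ctx T.sig n} {σ : Sub T.sig n m}
    (hσ : T.IsSub Δ Γ σ) (hA : T.Der Δ (.isTy (A.sub σ))) :
    T.IsSub (Δ.snoc (A.sub σ)) (Γ.snoc A) (Sub.up σ) := by
  rw [isSub_snoc]
  refine ⟨isSub_wk hσ hA, ?_⟩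
  have h := Derivable.ax hA
  rwa [Expr.sub_wk, Expr.wk_sub] at h

theorem isSub_id {Γ : Ctx T.sig n} (hΓ : T.Wf Γ) : T.IsSub Γ Γ (Sub.id n) := by
  induction hΓ with
  | nil => intro i; exact i.elim0
  | @snoc n Γ A hΓ hA ih =>
    have h := isSub_up (A := A) ih (by rwa [Expr.sub_id])
    rw [Expr.sub_id] at h
    rwa [show Sub.up (Sub.id (S := T.sig) n) = Sub.id (n + 1) from upN_id 1] at h

theorem isSub_proj {Γ : Ctx T.sig n} {A : Ty T.sig n} (h : T.Wf (Γ.snoc A)) :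
    T.IsSub (Γ.snoc A) Γ (Sub.proj n) :=
  (isSub_snoc.1 (isSub_id h)).1

theorem isSub_comp {Δ : Ctx T.sig m} {Γ : Ctx T.sig n} {Ξ : Ctx T.sig l} (hΔ : T.Wf Δ)
    {σ : Sub T.sig n m} {τ : Sub T.sig l n} (hσ : T.IsSub Δ Γ σ) (hτ : T.IsSub Γ Ξ τ) :
    T.IsSub Δ Ξ (Sub.comp τ σ) := by
  intro i
  have h := der_sub hΔ hσ (hτ i)
  simp only [Judg.sub, Expr.sub_sub] at h
  exact h

theorem wf_type {Γ : Ctx T.sig n} (hΓ : T.Wf Γ) (i : Fin n) : T.Der Γ (.isTy (Γ.type i)) := by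
  induction hΓ with
  | nil => exact i.elim0
  | @snoc n Γ A hΓ hA ih =>
    refine Fin.cases ?_ (fun j => ?_) i
    · have h := der_wk hA hA
      simp only [Judg.sub, ← wk_eq_sub] at h
      exact h
    · have h := der_wk (ih j) hA
      simp only [Judg.sub, ← wk_eq_sub] at h
      exact h

theorem ty_eqSub {Δ : Ctx T.sig m} {Γ : Ctx T.sig n} (hΔ : T.Wf Δ) {σ τ : Sub T.sig n m}
    (hσ : T.IsSub Δ Γ σ) (hτ : T.IsSub Δ Γ τ) (h : T.EqSub Δ Γ σ τ) {A : Ty T.sig n}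
    (hA : T.Der Γ (.isTy A)) : T.Der Δ (.eqTy (A.sub σ) (A.sub τ)) :=
  Derivable.ty_congr hA (der_sub hΔ hσ hA) hσ hτ h

theorem tm_eqSub {Δ : Ctx T.sig m} {Γ : Ctx T.sig n} (hΔ : T.Wf Δ) {σ τ : Sub T.sig n m}
    (hσ : T.IsSub Δ Γ σ) (hτ : T.IsSub Δ Γ τ) (h : T.EqSub Δ Γ σ τ) {a : Tm T.sig n}
    {A : Ty T.sig n} (ha : T.Der Γ (.hasTy a A)) :
    T.Der Δ (.eqTm (a.sub σ) (a.sub τ) (A.sub σ)) :=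
  Derivable.tm_congr ha (der_sub hΔ hσ ha) hσ hτ h

theorem eqSub_refl {Δ : Ctx T.sig m} {Γ : Ctx T.sig n} {σ : Sub T.sig n m}
    (hσ : T.IsSub Δ Γ σ) : T.EqSub Δ Γ σ σ := fun i => .tm_refl (hσ i)

theorem eqSub_symm {Δ : Ctx T.sig m} {Γ : Ctx T.sig n} (hΔ : T.Wf Δ) (hΓ : T.Wf Γ)
    {σ τ : Sub T.sig n m} (hσ : T.IsSub Δ Γ σ) (hτ : T.IsSub Δ Γ τ) (h : T.EqSub Δ Γ σ τ) :
    T.EqSub Δ Γ τ σ :=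
  fun i => .eq_conv (.tm_symm (h i)) (ty_eqSub hΔ hσ hτ h (wf_type hΓ i))

theorem eqSub_trans {Δ : Ctx T.sig m} {Γ : Ctx T.sig n} (hΔ : T.Wf Δ) (hΓ : T.Wf Γ)
    {σ τ υ : Sub T.sig n m} (hσ : T.IsSub Δ Γ σ) (hτ : T.IsSub Δ Γ τ) (h : T.EqSub Δ Γ σ τ)
    (h' : T.EqSub Δ Γ τ υ) : T.EqSub Δ Γ σ υ :=
  fun i => .tm_trans (h i) (.eq_conv (h' i) (.ty_symm (ty_eqSub hΔ hσ hτ h (wf_type hΓ i))))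

theorem eqSub_comp {Δ : Ctx T.sig m} {Γ : Ctx T.sig n} {Ξ : Ctx T.sig l} (hΔ : T.Wf Δ)
    (hΞ : T.Wf Ξ) {σ σ' : Sub T.sig n m} {τ τ' : Sub T.sig l n}
    (hσ : T.IsSub Δ Γ σ) (hσ' : T.IsSub Δ Γ σ') (hτ : T.IsSub Γ Ξ τ) (hτ' : T.IsSub Γ Ξ τ')
    (h : T.EqSub Δ Γ σ σ') (h' : T.EqSub Γ Ξ τ τ') :
    T.EqSub Δ Ξ (Sub.comp τ σ) (Sub.comp τ' σ') := by
  have h1 : T.EqSub Δ Ξ (Sub.comp τ σ) (Sub.comp τ' σ) := fun i => by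
    have := der_sub hΔ hσ (h' i)
    simp only [Judg.sub, Expr.sub_sub] at this
    exact this
  have h2 : T.EqSub Δ Ξ (Sub.comp τ' σ) (Sub.comp τ' σ') := fun i => by
    have := tm_eqSub hΔ hσ hσ' h (hτ' i)
    simp only [Expr.sub_sub] at this
    exact this
  exact eqSub_trans hΔ hΞ (isSub_comp hΔ hσ hτ) (isSub_comp hΔ hσ hτ') h1 h2

theorem eqCtx_isSub : ∀ {n : ℕ} {Γ Γ' : Ctx T.sig n}, T.Wf Γ → T.Wf Γ' → T.EqCtx Γ Γ' →
    T.IsSub Γ Γ' (Sub.id n) ∧ T.IsSub Γ' Γ (Sub.id n) := by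
  intro n Γ Γ' hΓ
  induction hΓ with
  | nil => intro _ _; cases Γ'; exact ⟨fun i => i.elim0, fun i => i.elim0⟩
  | @snoc n Γ A hΓ hA ih =>
    intro hΓ' h
    cases hΓ' with
    | @snoc _ Γ' A' hΓ' hA' =>
      obtain ⟨h1, h2⟩ := ih hΓ' h.1
      have key : ∀ {Δ Ξ : Ctx T.sig n} {B C : Ty T.sig n}, T.IsSub Δ Ξ (Sub.id n) →
          T.Der Δ (.isTy B) → T.Der Δ (.eqTy B C) →
          T.IsSub (Δ.snoc B) (Ξ.snoc C) (Sub.id (n + 1)) := by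
        intro Δ Ξ B C hs hB he
        rw [isSub_snoc]
        refine ⟨isSub_wk hs hB, ?_⟩
        have h3 := der_wk he hB
        simp only [Judg.sub] at h3
        have h4 := Derivable.ax hB
        rw [wk_eq_sub] at h4
        exact Derivable.tm_conv h4 h3
      refine ⟨key h1 hA h.2, key h2 hA' ?_⟩
      have h5 := der_sub hΓ' h2 (Derivable.ty_symm h.2)
      rwa [Judg.sub_id] at h5

/-- Derivability does not change when the context is replaced by a definitionally equal one. -/
theorem eqCtx_der {Γ Γ' : Ctx T.sig n} (hΓ : T.Wf Γ) (hΓ' : T.Wf Γ') (h : T.EqCtx Γ Γ')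
    (J : Judg T.sig n) : T.Der Γ J ↔ T.Der Γ' J := by
  obtain ⟨h1, h2⟩ := eqCtx_isSub hΓ hΓ' h
  constructor
  · intro hJ; have := der_sub hΓ' h2 hJ; rwa [Judg.sub_id] at this
  · intro hJ; have := der_sub hΓ h1 hJ; rwa [Judg.sub_id] at this

theorem eqCtx_refl : ∀ {n : ℕ} {Γ : Ctx T.sig n}, T.Wf Γ → T.EqCtx Γ Γ := by
  intro n Γ hΓ
  induction hΓ with
  | nil => trivial
  | snoc hΓ hA ih => exact ⟨ih, .ty_refl hA⟩

theorem eqCtx_symm : ∀ {n : ℕ} {Γ Γ' : Ctx T.sig n}, T.Wf Γ → T.Wf Γ' → T.EqCtx Γ Γ' →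
    T.EqCtx Γ' Γ := by
  intro n Γ Γ' hΓ
  induction hΓ with
  | nil => intro _ _; cases Γ'; trivial
  | @snoc n Γ A hΓ hA ih =>
    intro hΓ' h
    cases hΓ' with
    | @snoc _ Γ' A' hΓ' hA' =>
      exact ⟨ih hΓ' h.1, (eqCtx_der hΓ hΓ' h.1 _).1 (.ty_symm h.2)⟩

theorem eqCtx_trans : ∀ {n : ℕ} {Γ Γ' Γ'' : Ctx T.sig n}, T.Wf Γ → T.Wf Γ' → T.Wf Γ'' →
    T.EqCtx Γ Γ' → T.EqCtx Γ' Γ'' → T.EqCtx Γ Γ'' := by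
  intro n Γ Γ' Γ'' hΓ
  induction hΓ with
  | nil => intro _ _ _ _; cases Γ''; trivial
  | @snoc n Γ A hΓ hA ih =>
    intro hΓ' hΓ'' h h'
    cases hΓ' with
    | @snoc _ Γ' A' hΓ' hA' =>
      cases hΓ'' with
      | @snoc _ Γ'' A'' hΓ'' hA'' =>
        exact ⟨ih hΓ' hΓ'' h.1 h'.1, .ty_trans h.2 ((eqCtx_der hΓ hΓ' h.1 _).2 h'.2)⟩

theorem eqSub_cod {Δ : Ctx T.sig m} {Γ Γ' : Ctx T.sig n} (hΔ : T.Wf Δ) (hΓ : T.Wf Γ)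
    (hΓ' : T.Wf Γ') (h : T.EqCtx Γ Γ') {σ τ : Sub T.sig n m} (hσ : T.IsSub Δ Γ σ)
    (hτ : T.IsSub Δ Γ τ) (e : T.EqSub Δ Γ σ τ) : T.EqSub Δ Γ' σ τ :=
  eqSub_comp (τ := Sub.id n) (τ' := Sub.id n) hΔ hΓ' hσ hτ (eqCtx_isSub hΓ hΓ' h).1
    (eqCtx_isSub hΓ hΓ' h).1 e (eqSub_refl (eqCtx_isSub hΓ hΓ' h).1)

theorem isSub_cod {Δ : Ctx T.sig m} {Γ Γ' : Ctx T.sig n} (hΔ : T.Wf Δ) (hΓ : T.Wf Γ)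
    (hΓ' : T.Wf Γ') (h : T.EqCtx Γ Γ') {σ : Sub T.sig n m} (hσ : T.IsSub Δ Γ σ) :
    T.IsSub Δ Γ' σ :=
  isSub_comp (τ := Sub.id n) hΔ hσ (eqCtx_isSub hΓ hΓ' h).1

end Lemmas

/-- Well-formed contexts of length `n`, up to definitional equality. -/
def ctxSetoid (n : ℕ) : Setoid {Γ : Ctx T.sig n // T.Wf Γ} where
  r Γ Γ' := T.EqCtx Γ.1 Γ'.1
  iseqv :=
    ⟨fun Γ => eqCtx_refl Γ.2, fun {Γ Γ'} h => eqCtx_symm Γ.2 Γ'.2 h,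
      fun {Γ Γ' Γ''} h h' => eqCtx_trans Γ.2 Γ'.2 Γ''.2 h h'⟩

/-- The objects of the classifying category of `T`: equivalence classes of well-formed contexts of
the same length `len`. -/
structure ClassifyingCat where
  len : ℕ
  cls : Quotient (T.ctxSetoid len)

variable {T}

/-- The object of the classifying category given by a well-formed context. -/
def ob {n : ℕ} (Γ : Ctx T.sig n) (hΓ : T.Wf Γ) : T.ClassifyingCat :=
  ⟨n, Quotient.mk (T.ctxSetoid n) ⟨Γ, hΓ⟩⟩

namespace ClassifyingCat

/-- `T.IsSub` on equivalence classes of contexts. -/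
def IsSub (X Y : T.ClassifyingCat) (σ : Sub T.sig Y.len X.len) : Prop :=
  Quotient.liftOn₂ X.cls Y.cls (fun Δ Γ => T.IsSub Δ.1 Γ.1 σ) (by
    intro Δ Γ Δ' Γ' hΔ hΓ
    have h1 : T.IsSub Δ.1 Γ.1 σ ↔ T.IsSub Δ'.1 Γ.1 σ :=
      forall_congr' fun i => eqCtx_der Δ.2 Δ'.2 hΔ _
    refine propext (h1.trans ⟨?_, ?_⟩)
    · exact isSub_cod Δ'.2 Γ.2 Γ'.2 hΓ
    · exact isSub_cod Δ'.2 Γ'.2 Γ.2 (eqCtx_symm Γ.2 Γ'.2 hΓ))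

/-- The context morphisms between two classes of contexts. -/
def PreHom (X Y : T.ClassifyingCat) : Type u := {σ : Sub T.sig Y.len X.len // X.IsSub Y σ}

/-- `T.EqSub` on equivalence classes of contexts. -/
def EqSub (X Y : T.ClassifyingCat) (σ τ : PreHom X Y) : Prop :=
  Quotient.liftOn₂ X.cls Y.cls
    (fun Δ Γ => T.IsSub Δ.1 Γ.1 σ.1 ∧ T.IsSub Δ.1 Γ.1 τ.1 ∧ T.EqSub Δ.1 Γ.1 σ.1 τ.1) (by
    intro Δ Γ Δ' Γ' hΔ hΓ
    have h1 : (T.IsSub Δ.1 Γ.1 σ.1 ∧ T.IsSub Δ.1 Γ.1 τ.1 ∧ T.EqSub Δ.1 Γ.1 σ.1 τ.1) ↔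
        (T.IsSub Δ'.1 Γ.1 σ.1 ∧ T.IsSub Δ'.1 Γ.1 τ.1 ∧ T.EqSub Δ'.1 Γ.1 σ.1 τ.1) :=
      and_congr (forall_congr' fun i => eqCtx_der Δ.2 Δ'.2 hΔ _)
        (and_congr (forall_congr' fun i => eqCtx_der Δ.2 Δ'.2 hΔ _)
          (forall_congr' fun i => eqCtx_der Δ.2 Δ'.2 hΔ _))
    refine propext (h1.trans ⟨?_, ?_⟩)
    · rintro ⟨a, b, c⟩
      exact ⟨isSub_cod Δ'.2 Γ.2 Γ'.2 hΓ a, isSub_cod Δ'.2 Γ.2 Γ'.2 hΓ b,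
        eqSub_cod Δ'.2 Γ.2 Γ'.2 hΓ a b c⟩
    · have hΓ' := eqCtx_symm Γ.2 Γ'.2 hΓ
      rintro ⟨a, b, c⟩
      exact ⟨isSub_cod Δ'.2 Γ'.2 Γ.2 hΓ' a, isSub_cod Δ'.2 Γ'.2 Γ.2 hΓ' b,
        eqSub_cod Δ'.2 Γ'.2 Γ.2 hΓ' a b c⟩)

theorem ind {P : T.ClassifyingCat → Prop}
    (h : ∀ {n : ℕ} (Γ : Ctx T.sig n) (hΓ : T.Wf Γ), P (ob Γ hΓ)) (X : T.ClassifyingCat) : P X := by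
  obtain ⟨n, q⟩ := X
  induction q using Quotient.ind with
  | _ Γ => exact h Γ.1 Γ.2

theorem eqSub_ob_iff {m n : ℕ} {Δ : Ctx T.sig m} {hΔ : T.Wf Δ} {Γ : Ctx T.sig n} {hΓ : T.Wf Γ}
    (σ τ : PreHom (ob Δ hΔ) (ob Γ hΓ)) :
    EqSub _ _ σ τ ↔ T.EqSub Δ Γ σ.1 τ.1 :=
  ⟨fun h => h.2.2, fun h => ⟨σ.2, τ.2, h⟩⟩

theorem eqSub_equivalence (X Y : T.ClassifyingCat) : Equivalence (EqSub X Y) := by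
  induction X using ind with
  | _ Δ hΔ =>
  induction Y using ind with
  | _ Γ hΓ =>
  refine ⟨fun σ => ?_, fun {σ τ} h => ?_, fun {σ τ υ} h h' => ?_⟩
  · exact (eqSub_ob_iff σ σ).2 (eqSub_refl σ.2)
  · exact (eqSub_ob_iff τ σ).2 (eqSub_symm hΔ hΓ σ.2 τ.2 ((eqSub_ob_iff σ τ).1 h))
  · exact (eqSub_ob_iff σ υ).2 (eqSub_trans hΔ hΓ σ.2 τ.2 ((eqSub_ob_iff σ τ).1 h)
      ((eqSub_ob_iff τ υ).1 h'))

/-- Context morphisms up to definitional equality. -/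
def homSetoid (X Y : T.ClassifyingCat) : Setoid (PreHom X Y) := ⟨EqSub X Y, eqSub_equivalence X Y⟩

def idPre (X : T.ClassifyingCat) : PreHom X X :=
  ⟨Sub.id _, by induction X using ind with | _ Γ hΓ => exact isSub_id hΓ⟩

def compPre {X Y Z : T.ClassifyingCat} (f : PreHom X Y) (g : PreHom Y Z) : PreHom X Z :=
  ⟨Sub.comp g.1 f.1, by
    induction X using ind with
    | _ Δ hΔ =>
    induction Y using ind with
    | _ Γ hΓ =>
    induction Z using ind with
    | _ Ξ hΞ => exact isSub_comp hΔ f.2 g.2⟩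

theorem compPre_congr {X Y Z : T.ClassifyingCat} (f f' : PreHom X Y) (g g' : PreHom Y Z)
    (hf : EqSub X Y f f') (hg : EqSub Y Z g g') : EqSub X Z (compPre f g) (compPre f' g') := by
  induction X using ind with
  | _ Δ hΔ =>
  induction Y using ind with
  | _ Γ hΓ =>
  induction Z using ind with
  | _ Ξ hΞ =>
  exact (eqSub_ob_iff _ _).2 (eqSub_comp hΔ hΞ f.2 f'.2 g.2 g'.2 ((eqSub_ob_iff _ _).1 hf)
    ((eqSub_ob_iff _ _).1 hg))

instance : Category.{u} T.ClassifyingCat where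
  Hom X Y := Quotient (homSetoid X Y)
  id X := Quotient.mk _ (idPre X)
  comp {X Y Z} f g := Quotient.liftOn₂ f g (fun f g => Quotient.mk (homSetoid X Z) (compPre f g))
    (fun f g f' g' hf hg => Quotient.sound (compPre_congr f f' g g' hf hg))
  id_comp {X Y} f := by
    induction f using Quotient.ind with
    | _ f => exact congrArg (Quotient.mk _) (Subtype.ext (funext fun i => Expr.sub_id _))
  comp_id {X Y} f := by
    induction f using Quotient.ind with
    | _ f => rfl
  assoc {W X Y Z} f g h := by
    induction f using Quotient.ind with
    | _ f =>
    induction g using Quotient.ind with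
    | _ g =>
    induction h using Quotient.ind with
    | _ h =>
      exact congrArg (Quotient.mk _) (Subtype.ext (funext fun i => (Expr.sub_sub _ _ _).symm))

end ClassifyingCat

/-- The morphism of the classifying category given by a context morphism. -/
def homOf {m n : ℕ} {Δ : Ctx T.sig m} {Γ : Ctx T.sig n} (hΔ : T.Wf Δ) (hΓ : T.Wf Γ)
    (σ : Sub T.sig n m) (hσ : T.IsSub Δ Γ σ) : ob Δ hΔ ⟶ ob Γ hΓ :=
  Quotient.mk (ClassifyingCat.homSetoid (ob Δ hΔ) (ob Γ hΓ)) ⟨σ, hσ⟩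

/-- The display map `[Γ, x ∈ A] → Γ`. -/
def display {n : ℕ} {Γ : Ctx T.sig n} {A : Ty T.sig n} (hΓ : T.Wf Γ) (hA : T.Wf (Γ.snoc A)) :
    ob (Γ.snoc A) hA ⟶ ob Γ hΓ :=
  homOf hA hΓ (Sub.proj n) (isSub_proj hA)

/-- The dependent projections: the finite composites `[Γ, Δ] → Γ` of display maps. -/
inductive IsDepProj : {X Y : T.ClassifyingCat} → (X ⟶ Y) → Prop
  | id (X : T.ClassifyingCat) : IsDepProj (𝟙 X)
  | display_comp {n : ℕ} {Γ : Ctx T.sig n} {A : Ty T.sig n} (hΓ : T.Wf Γ)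
      (hA : T.Wf (Γ.snoc A)) {Y : T.ClassifyingCat} (f : ob Γ hΓ ⟶ Y) (hf : IsDepProj f) :
      IsDepProj (display hΓ hA ≫ f)

variable (T)

/-- The dependent projections as a class of morphisms. -/
def depProjections : MorphismProperty T.ClassifyingCat := fun _ _ f => IsDepProj f

/-- The fibrations of the classifying category: the morphisms that are isomorphic to a dependent
projection. -/
def fibrations : MorphismProperty T.ClassifyingCat := T.depProjections.isoClosure

/-! ### Strong sums and propositional identity types

A type or term former is an operation on raw expressions that commutes with substitution. It may
take the types that are involved as arguments, although it need not depend on them. -/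

/-- Strong unit and sum types, with congruence rules. -/
structure StrongSums where
  unit : (n : ℕ) → Ty T.sig n
  star : (n : ℕ) → Tm T.sig n
  Sig : {n : ℕ} → (A : Ty T.sig n) → (B : Ty T.sig (n + 1)) → Ty T.sig n
  pair : {n : ℕ} → (A : Ty T.sig n) → (B : Ty T.sig (n + 1)) → (a b : Tm T.sig n) → Tm T.sig n
  fst : {n : ℕ} → (A : Ty T.sig n) → (B : Ty T.sig (n + 1)) → (c : Tm T.sig n) → Tm T.sig n
  snd : {n : ℕ} → (A : Ty T.sig n) → (B : Ty T.sig (n + 1)) → (c : Tm T.sig n) → Tm T.sig n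
  -- the formers commute with substitution
  unit_sub : ∀ {n m : ℕ} (σ : Sub T.sig n m), (unit n).sub σ = unit m
  star_sub : ∀ {n m : ℕ} (σ : Sub T.sig n m), (star n).sub σ = star m
  Sig_sub : ∀ {n m : ℕ} (A : Ty T.sig n) (B : Ty T.sig (n + 1)) (σ : Sub T.sig n m),
    (Sig A B).sub σ = Sig (A.sub σ) (B.sub σ.up)
  pair_sub : ∀ {n m : ℕ} (A : Ty T.sig n) (B : Ty T.sig (n + 1)) (a b : Tm T.sig n)
    (σ : Sub T.sig n m),
    (pair A B a b).sub σ = pair (A.sub σ) (B.sub σ.up) (a.sub σ) (b.sub σ)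
  fst_sub : ∀ {n m : ℕ} (A : Ty T.sig n) (B : Ty T.sig (n + 1)) (c : Tm T.sig n)
    (σ : Sub T.sig n m), (fst A B c).sub σ = fst (A.sub σ) (B.sub σ.up) (c.sub σ)
  snd_sub : ∀ {n m : ℕ} (A : Ty T.sig n) (B : Ty T.sig (n + 1)) (c : Tm T.sig n)
    (σ : Sub T.sig n m), (snd A B c).sub σ = snd (A.sub σ) (B.sub σ.up) (c.sub σ)
  -- rules for the unit type
  unit_form : ∀ {n : ℕ} {Γ : Ctx T.sig n}, T.Wf Γ → T.Der Γ (.isTy (unit n))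
  star_intro : ∀ {n : ℕ} {Γ : Ctx T.sig n}, T.Wf Γ → T.Der Γ (.hasTy (star n) (unit n))
  unit_eta : ∀ {n : ℕ} {Γ : Ctx T.sig n} {a : Tm T.sig n}, T.Der Γ (.hasTy a (unit n)) →
    T.Der Γ (.eqTm a (star n) (unit n))
  -- rules for sum types
  Sig_form : ∀ {n : ℕ} {Γ : Ctx T.sig n} {A : Ty T.sig n} {B : Ty T.sig (n + 1)},
    T.Der Γ (.isTy A) → T.Der (Γ.snoc A) (.isTy B) → T.Der Γ (.isTy (Sig A B))
  pair_intro : ∀ {n : ℕ} {Γ : Ctx T.sig n} {A : Ty T.sig n} {B : Ty T.sig (n + 1)}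
    {a b : Tm T.sig n}, T.Der Γ (.isTy A) → T.Der (Γ.snoc A) (.isTy B) → T.Der Γ (.hasTy a A) →
    T.Der Γ (.hasTy b (B.sub (.inst a))) → T.Der Γ (.hasTy (pair A B a b) (Sig A B))
  fst_elim : ∀ {n : ℕ} {Γ : Ctx T.sig n} {A : Ty T.sig n} {B : Ty T.sig (n + 1)}
    {c : Tm T.sig n}, T.Der Γ (.isTy A) → T.Der (Γ.snoc A) (.isTy B) →
    T.Der Γ (.hasTy c (Sig A B)) → T.Der Γ (.hasTy (fst A B c) A)
  snd_elim : ∀ {n : ℕ} {Γ : Ctx T.sig n} {A : Ty T.sig n} {B : Ty T.sig (n + 1)}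
    {c : Tm T.sig n}, T.Der Γ (.isTy A) → T.Der (Γ.snoc A) (.isTy B) →
    T.Der Γ (.hasTy c (Sig A B)) → T.Der Γ (.hasTy (snd A B c) (B.sub (.inst (fst A B c))))
  fst_pair : ∀ {n : ℕ} {Γ : Ctx T.sig n} {A : Ty T.sig n} {B : Ty T.sig (n + 1)}
    {a b : Tm T.sig n}, T.Der Γ (.isTy A) → T.Der (Γ.snoc A) (.isTy B) → T.Der Γ (.hasTy a A) →
    T.Der Γ (.hasTy b (B.sub (.inst a))) → T.Der Γ (.eqTm (fst A B (pair A B a b)) a A)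
  snd_pair : ∀ {n : ℕ} {Γ : Ctx T.sig n} {A : Ty T.sig n} {B : Ty T.sig (n + 1)}
    {a b : Tm T.sig n}, T.Der Γ (.isTy A) → T.Der (Γ.snoc A) (.isTy B) → T.Der Γ (.hasTy a A) →
    T.Der Γ (.hasTy b (B.sub (.inst a))) →
    T.Der Γ (.eqTm (snd A B (pair A B a b)) b (B.sub (.inst a)))
  pair_eta : ∀ {n : ℕ} {Γ : Ctx T.sig n} {A : Ty T.sig n} {B : Ty T.sig (n + 1)}
    {c : Tm T.sig n}, T.Der Γ (.isTy A) → T.Der (Γ.snoc A) (.isTy B) →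
    T.Der Γ (.hasTy c (Sig A B)) →
    T.Der Γ (.eqTm (pair A B (fst A B c) (snd A B c)) c (Sig A B))
  -- congruence rules
  Sig_congr : ∀ {n : ℕ} {Γ : Ctx T.sig n} {A A' : Ty T.sig n} {B B' : Ty T.sig (n + 1)},
    T.Der Γ (.eqTy A A') → T.Der (Γ.snoc A) (.eqTy B B') →
    T.Der Γ (.eqTy (Sig A B) (Sig A' B'))
  pair_congr : ∀ {n : ℕ} {Γ : Ctx T.sig n} {A A' : Ty T.sig n} {B B' : Ty T.sig (n + 1)}
    {a a' b b' : Tm T.sig n}, T.Der Γ (.eqTy A A') → T.Der (Γ.snoc A) (.eqTy B B') →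
    T.Der Γ (.eqTm a a' A) → T.Der Γ (.eqTm b b' (B.sub (.inst a))) →
    T.Der Γ (.eqTm (pair A B a b) (pair A' B' a' b') (Sig A B))
  fst_congr : ∀ {n : ℕ} {Γ : Ctx T.sig n} {A A' : Ty T.sig n} {B B' : Ty T.sig (n + 1)}
    {c c' : Tm T.sig n}, T.Der Γ (.eqTy A A') → T.Der (Γ.snoc A) (.eqTy B B') →
    T.Der Γ (.eqTm c c' (Sig A B)) → T.Der Γ (.eqTm (fst A B c) (fst A' B' c') A)
  snd_congr : ∀ {n : ℕ} {Γ : Ctx T.sig n} {A A' : Ty T.sig n} {B B' : Ty T.sig (n + 1)}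
    {c c' : Tm T.sig n}, T.Der Γ (.eqTy A A') → T.Der (Γ.snoc A) (.eqTy B B') →
    T.Der Γ (.eqTm c c' (Sig A B)) →
    T.Der Γ (.eqTm (snd A B c) (snd A' B' c') (B.sub (.inst (fst A B c))))

/-- The type and term formers of propositional identity types. In `J` and `H` the variables
`x, y, u` are the last three variables of a context of length `n + 3`, and `Θ` is the context
parameter, whose `k` variables may occur in the result. -/
structure IdFormers where
  Id : {n : ℕ} → (A : Ty T.sig n) → (a b : Tm T.sig n) → Ty T.sig n
  r : {n : ℕ} → (A : Ty T.sig n) → (a : Tm T.sig n) → Tm T.sig n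
  J : {n k : ℕ} → (A : Ty T.sig n) → (Θ : Tel T.sig (n + 3) k) →
    (C : Ty T.sig (ext (n + 3) k)) → (a b p : Tm T.sig n) → (d : Tm T.sig (ext (n + 1) k)) →
    Tm T.sig (ext n k)
  H : {n k : ℕ} → (A : Ty T.sig n) → (Θ : Tel T.sig (n + 3) k) →
    (C : Ty T.sig (ext (n + 3) k)) → (a : Tm T.sig n) → (d : Tm T.sig (ext (n + 1) k)) →
    Tm T.sig (ext n k)
  Id_sub : ∀ {n m : ℕ} (A : Ty T.sig n) (a b : Tm T.sig n) (σ : Sub T.sig n m),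
    (Id A a b).sub σ = Id (A.sub σ) (a.sub σ) (b.sub σ)
  r_sub : ∀ {n m : ℕ} (A : Ty T.sig n) (a : Tm T.sig n) (σ : Sub T.sig n m),
    (r A a).sub σ = r (A.sub σ) (a.sub σ)
  J_sub : ∀ {n m k : ℕ} (A : Ty T.sig n) (Θ : Tel T.sig (n + 3) k)
    (C : Ty T.sig (ext (n + 3) k)) (a b p : Tm T.sig n) (d : Tm T.sig (ext (n + 1) k))
    (σ : Sub T.sig n m), (J A Θ C a b p d).sub (.upN k σ) =
      J (A.sub σ) (Θ.sub σ.up.up.up) (C.sub (.upN k σ.up.up.up)) (a.sub σ) (b.sub σ) (p.sub σ)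
        (d.sub (.upN k σ.up))
  H_sub : ∀ {n m k : ℕ} (A : Ty T.sig n) (Θ : Tel T.sig (n + 3) k)
    (C : Ty T.sig (ext (n + 3) k)) (a : Tm T.sig n) (d : Tm T.sig (ext (n + 1) k))
    (σ : Sub T.sig n m), (H A Θ C a d).sub (.upN k σ) =
      H (A.sub σ) (Θ.sub σ.up.up.up) (C.sub (.upN k σ.up.up.up)) (a.sub σ) (d.sub (.upN k σ.up))

variable {T}

/-- The context `[Γ, x ∈ A, y ∈ A, u ∈ Id_A(x, y)]`. -/
def IdFormers.idCtx (F : T.IdFormers) {n : ℕ} (Γ : Ctx T.sig n) (A : Ty T.sig n) :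
    Ctx T.sig (n + 3) :=
  ((Γ.snoc A).snoc A.wk).snoc (F.Id A.wk.wk (.var 1) (.var 0))

/-- The substitution `x, y, u := x, x, r(x)`. -/
def IdFormers.diag (F : T.IdFormers) {n : ℕ} (A : Ty T.sig n) : Sub T.sig (n + 3) (n + 1) :=
  .cons (F.r A.wk (.var 0)) (.cons (.var 0) (.id (n + 1)))

variable (T)

/-- The substitution `x, y, u := a, b, p`. -/
def inst₃ {n : ℕ} (a b p : Tm T.sig n) : Sub T.sig (n + 3) n :=
  .cons p (.cons b (.cons a (.id n)))

/-- Definitional equality of extensions of a context. -/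
def EqTel : {n k : ℕ} → Ctx T.sig n → Tel T.sig n k → Tel T.sig n k → Prop
  | _, _, _, .nil, .nil => True
  | _, _, Γ, .cons A Θ, .cons A' Θ' => T.Der Γ (.eqTy A A') ∧ EqTel (Γ.snoc A) Θ Θ'

/-- Propositional identity types, with congruence rules. -/
structure PropIdTypes extends T.IdFormers where
  formation : ∀ {n : ℕ} {Γ : Ctx T.sig n} {A : Ty T.sig n} {a b : Tm T.sig n},
    T.Der Γ (.isTy A) → T.Der Γ (.hasTy a A) → T.Der Γ (.hasTy b A) → T.Der Γ (.isTy (Id A a b))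
  introduction : ∀ {n : ℕ} {Γ : Ctx T.sig n} {A : Ty T.sig n} {a : Tm T.sig n},
    T.Der Γ (.isTy A) → T.Der Γ (.hasTy a A) → T.Der Γ (.hasTy (r A a) (Id A a a))
  elimination : ∀ {n k : ℕ} {Γ : Ctx T.sig n} {A : Ty T.sig n} {Θ : Tel T.sig (n + 3) k}
    {C : Ty T.sig (ext (n + 3) k)} {a b p : Tm T.sig n} {d : Tm T.sig (ext (n + 1) k)},
    T.Der ((toIdFormers.idCtx Γ A).append Θ) (.isTy C) →
    T.Der Γ (.hasTy a A) → T.Der Γ (.hasTy b A) → T.Der Γ (.hasTy p (Id A a b)) →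
    T.Der ((Γ.snoc A).append (Θ.sub (toIdFormers.diag A)))
      (.hasTy d (C.sub (.upN k (toIdFormers.diag A)))) →
    T.Der (Γ.append (Θ.sub (T.inst₃ a b p)))
      (.hasTy (J A Θ C a b p d) (C.sub (.upN k (T.inst₃ a b p))))
  computation : ∀ {n k : ℕ} {Γ : Ctx T.sig n} {A : Ty T.sig n} {Θ : Tel T.sig (n + 3) k}
    {C : Ty T.sig (ext (n + 3) k)} {a : Tm T.sig n} {d : Tm T.sig (ext (n + 1) k)},
    T.Der ((toIdFormers.idCtx Γ A).append Θ) (.isTy C) →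
    T.Der Γ (.hasTy a A) →
    T.Der ((Γ.snoc A).append (Θ.sub (toIdFormers.diag A)))
      (.hasTy d (C.sub (.upN k (toIdFormers.diag A)))) →
    T.Der (Γ.append (Θ.sub (T.inst₃ a a (r A a))))
      (.hasTy (H A Θ C a d)
        (Id (C.sub (.upN k (T.inst₃ a a (r A a)))) (J A Θ C a a (r A a) d)
          (d.sub (.upN k (.inst a)))))
  Id_congr : ∀ {n : ℕ} {Γ : Ctx T.sig n} {A A' : Ty T.sig n} {a a' b b' : Tm T.sig n},
    T.Der Γ (.eqTy A A') → T.Der Γ (.eqTm a a' A) → T.Der Γ (.eqTm b b' A) →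
    T.Der Γ (.eqTy (Id A a b) (Id A' a' b'))
  r_congr : ∀ {n : ℕ} {Γ : Ctx T.sig n} {A A' : Ty T.sig n} {a a' : Tm T.sig n},
    T.Der Γ (.eqTy A A') → T.Der Γ (.eqTm a a' A) →
    T.Der Γ (.eqTm (r A a) (r A' a') (Id A a a))
  J_congr : ∀ {n k : ℕ} {Γ : Ctx T.sig n} {A A' : Ty T.sig n} {Θ Θ' : Tel T.sig (n + 3) k}
    {C C' : Ty T.sig (ext (n + 3) k)} {a a' b b' p p' : Tm T.sig n}
    {d d' : Tm T.sig (ext (n + 1) k)},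
    T.Der Γ (.eqTy A A') → T.EqTel (toIdFormers.idCtx Γ A) Θ Θ' →
    T.Der ((toIdFormers.idCtx Γ A).append Θ) (.eqTy C C') →
    T.Der Γ (.eqTm a a' A) → T.Der Γ (.eqTm b b' A) → T.Der Γ (.eqTm p p' (Id A a b)) →
    T.Der ((Γ.snoc A).append (Θ.sub (toIdFormers.diag A)))
      (.eqTm d d' (C.sub (.upN k (toIdFormers.diag A)))) →
    T.Der (Γ.append (Θ.sub (T.inst₃ a b p)))
      (.eqTm (J A Θ C a b p d) (J A' Θ' C' a' b' p' d') (C.sub (.upN k (T.inst₃ a b p))))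
  H_congr : ∀ {n k : ℕ} {Γ : Ctx T.sig n} {A A' : Ty T.sig n} {Θ Θ' : Tel T.sig (n + 3) k}
    {C C' : Ty T.sig (ext (n + 3) k)} {a a' : Tm T.sig n} {d d' : Tm T.sig (ext (n + 1) k)},
    T.Der Γ (.eqTy A A') → T.EqTel (toIdFormers.idCtx Γ A) Θ Θ' →
    T.Der ((toIdFormers.idCtx Γ A).append Θ) (.eqTy C C') →
    T.Der Γ (.eqTm a a' A) →
    T.Der ((Γ.snoc A).append (Θ.sub (toIdFormers.diag A)))
      (.eqTm d d' (C.sub (.upN k (toIdFormers.diag A)))) →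
    T.Der (Γ.append (Θ.sub (T.inst₃ a a (r A a))))
      (.eqTm (H A Θ C a d) (H A' Θ' C' a' d')
        (Id (C.sub (.upN k (T.inst₃ a a (r A a)))) (J A Θ C a a (r A a) d)
          (d.sub (.upN k (.inst a)))))

end TypeTheory

/-! ### Tribes -/

section Tribes

universe v w

variable {C : Type w} [Category.{v} C]

/-- The category `C` with the class `F` of fibrations is a tribe. -/
structure IsTribe (F : MorphismProperty C) : Prop where
  hasTerminal : HasTerminal C
  iso_mem : ∀ {X Y : C} (f : X ⟶ Y), IsIso f → F f
  comp_mem : ∀ {X Y Z : C} (f : X ⟶ Y) (g : Y ⟶ Z), F f → F g → F (f ≫ g)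
  toTerminal_mem : ∀ {X Z : C} (_ : IsTerminal Z) (f : X ⟶ Z), F f
  pullback : ∀ {X' X Y : C} (p : X' ⟶ X) (f : Y ⟶ X), F p →
    ∃ (Y' : C) (q : Y' ⟶ Y) (f' : Y' ⟶ X'), IsPullback f' q p f ∧ F q

/-- A factorisation of the diagonal `A → A ×_I A` of `α : A → I` as a map `r : A → P_I A` followed
by a fibration `(s, t) : P_I A → A ×_I A`. -/
structure PathFactorisation (F : MorphismProperty C) {A I : C} (α : A ⟶ I) where
  P : C
  r : A ⟶ P
  s : P ⟶ A
  t : P ⟶ A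
  w : s ≫ α = t ≫ α
  r_s : r ≫ s = 𝟙 A
  r_t : r ≫ t = 𝟙 A
  fib : ∀ {Q : C} {π₁ π₂ : Q ⟶ A} (h : IsPullback π₁ π₂ α α), F (h.lift s t w)

/-- Propositional identity types in a tribe with class `F` of fibrations: a choice of `P_I A` for
all fibrations `A → I` with conditions (1) and (2). -/
def HasPropositionalIdentityTypes (F : MorphismProperty C) : Prop :=
  ∃ P : ∀ {A I : C} (α : A ⟶ I), F α → PathFactorisation F α,
    -- (1) every pullback `g : V → U` of `r : A → P_I A` along a fibration has weak fillers against
    -- every fibration `f : B → D`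
    (∀ {A I : C} (α : A ⟶ I) (hα : F α) {U V : C} (q : U ⟶ (P α hα).P) (g : V ⟶ U) (q' : V ⟶ A),
      F q → IsPullback g q' q (P α hα).r →
      ∀ {B D : C} (f : B ⟶ D) (hf : F f) (k : V ⟶ B) (l : U ⟶ D), k ≫ f = g ≫ l →
        ∃ (d : U ⟶ B) (H : V ⟶ (P f hf).P),
          d ≫ f = l ∧ H ≫ (P f hf).s = g ≫ d ∧ H ≫ (P f hf).t = k) ∧
    -- (2) if `α' : A' → J` is a pullback of `α : A → I` along `κ : J → I` and `Q → J` is a pullback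
    -- of `P_I A → I` along `κ`, with induced maps `s', t' : Q → A'`, then there are morphisms in
    -- both directions between `P_J A'` and `Q` over `A' ×_J A'`
    (∀ {A I J A' Q : C} (α : A ⟶ I) (hα : F α) (κ : J ⟶ I) (κ' : A' ⟶ A) (α' : A' ⟶ J)
      (hα' : F α') (e : Q ⟶ (P α hα).P) (β : Q ⟶ J) (s' t' : Q ⟶ A'),
      IsPullback κ' α' α κ → IsPullback e β ((P α hα).s ≫ α) κ →
      s' ≫ κ' = e ≫ (P α hα).s → s' ≫ α' = β → t' ≫ κ' = e ≫ (P α hα).t → t' ≫ α' = β →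
      (∃ φ : (P α' hα').P ⟶ Q, φ ≫ s' = (P α' hα').s ∧ φ ≫ t' = (P α' hα').t) ∧
      (∃ ψ : Q ⟶ (P α' hα').P, ψ ≫ (P α' hα').s = s' ∧ ψ ≫ (P α' hα').t = t'))

end Tribes

end DTT

namespace DTT

namespace TypeTheory

/-! Strong sums make every fibration isomorphic to a single display map `[Γ, x ∈ A] → Γ`: an
identity is the display map of the unit type, and two consecutive display maps merge into the
display map of a sum type (`exists_iso_snoc_unit`, `exists_iso_snoc_Sig`, combined in
`nonempty_displayRep`). The tribe axioms follow, since the pullback of a display map along `σ` is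
the display map of `A[σ]` (`isPullback_display`).

The path object of a fibration presented by `A` over `Γ` is `[Γ, x ∈ A, y ∈ A, u ∈ Id_A(x, y)]`. Up
to isomorphism, a pullback of its reflexivity map along a fibration is the inclusion of `[Γ, x ∈ A,
z ∈ B(x, x, r(x))]` into `[Γ, x, y, u, z ∈ B(x, y, u)]`, so a parameter context of length one in `J`
is enough. A lifting problem against the display map of `C` over `Ξ`, with lower map `ρ`, is a term
of `C[ρ]` given on the diagonal. `J` extends it to a term `j` of `C[ρ]`; the filler `(ρ, j)` lies
strictly over `ρ`, and `H` is a path in the fibre from the restriction of `j` to the given term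
(`exists_elim`, `exists_filler`). This is condition (1).

For condition (2), `Id` commutes with substitution, so the pullback of the path context of `A` along
`σ` is the path context of `A[σ]` (`idDisplay_sub`). This is the path object for one presentation of
the pulled back fibration, perhaps not the chosen one. Two path objects of the same map are however
compared by condition (1) itself: the reflexivity map of one is filled along that of the other, and
the homotopy is discarded (`DisplayRep.exists_comparison`). Hence presentations may be chosen
arbitrarily and independently. -/

theorem isPullback_of_exists_unique {C : Type*} [Category C] {P X Y Z : C} {fst : P ⟶ X}
    {snd : P ⟶ Y} {f : X ⟶ Z} {g : Y ⟶ Z} (w : fst ≫ f = snd ≫ g)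
    (hex : ∀ {W : C} (a : W ⟶ X) (b : W ⟶ Y), a ≫ f = b ≫ g →
      ∃ c : W ⟶ P, c ≫ fst = a ∧ c ≫ snd = b)
    (huniq : ∀ {W : C} (c c' : W ⟶ P), c ≫ fst = c' ≫ fst → c ≫ snd = c' ≫ snd → c = c') :
    IsPullback fst snd f g := by
  choose c h₁ h₂ using @hex
  exact ⟨⟨w⟩, ⟨PullbackCone.IsLimit.mk w (fun s => c s.fst s.snd s.condition)
    (fun s => h₁ _ _ _) (fun s => h₂ _ _ _)
    (fun s k hk₁ hk₂ => huniq _ _ (hk₁.trans (h₁ _ _ _).symm) (hk₂.trans (h₂ _ _ _).symm))⟩⟩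

/-! ### Morphisms as substitutions, and pullbacks of display maps -/

section Homs

variable {T : TypeTheory.{u}} {m n l : ℕ}

theorem isTy_of_wf_snoc {Γ : Ctx T.sig n} {A : Ty T.sig n} (h : T.Wf (Γ.snoc A)) :
    T.Der Γ (.isTy A) := by
  cases h; assumption

theorem exists_homOf {Δ : Ctx T.sig m} {Γ : Ctx T.sig n} {hΔ : T.Wf Δ} {hΓ : T.Wf Γ}
    (f : ob Δ hΔ ⟶ ob Γ hΓ) : ∃ σ, ∃ hσ : T.IsSub Δ Γ σ, f = homOf hΔ hΓ σ hσ := by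
  induction f using Quotient.ind with
  | _ f => exact ⟨f.1, f.2, rfl⟩

theorem homOf_eq_iff {Δ : Ctx T.sig m} {Γ : Ctx T.sig n} {hΔ : T.Wf Δ} {hΓ : T.Wf Γ}
    {σ τ : Sub T.sig n m} {hσ : T.IsSub Δ Γ σ} {hτ : T.IsSub Δ Γ τ} :
    homOf hΔ hΓ σ hσ = homOf hΔ hΓ τ hτ ↔ T.EqSub Δ Γ σ τ := by
  constructor
  · intro h
    exact (ClassifyingCat.eqSub_ob_iff _ _).1 (Quotient.exact h)
  · intro h
    exact Quotient.sound ((ClassifyingCat.eqSub_ob_iff _ _).2 h)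

theorem homOf_comp {Δ : Ctx T.sig m} {Γ : Ctx T.sig n} {Ξ : Ctx T.sig l} {hΔ : T.Wf Δ}
    {hΓ : T.Wf Γ} {hΞ : T.Wf Ξ} {σ : Sub T.sig n m} {τ : Sub T.sig l n} (hσ : T.IsSub Δ Γ σ)
    (hτ : T.IsSub Γ Ξ τ) :
    homOf hΔ hΓ σ hσ ≫ homOf hΓ hΞ τ hτ = homOf hΔ hΞ (Sub.comp τ σ) (isSub_comp hΔ hσ hτ) :=
  rfl

theorem homOf_id {Γ : Ctx T.sig n} (hΓ : T.Wf Γ) :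
    homOf hΓ hΓ (Sub.id n) (isSub_id hΓ) = 𝟙 (ob Γ hΓ) := rfl

theorem homOf_congr {Δ : Ctx T.sig m} {Γ : Ctx T.sig n} {hΔ : T.Wf Δ} {hΓ : T.Wf Γ}
    {σ τ : Sub T.sig n m} {hσ : T.IsSub Δ Γ σ} {hτ : T.IsSub Δ Γ τ} (h : σ = τ) :
    homOf hΔ hΓ σ hσ = homOf hΔ hΓ τ hτ := by
  subst h; rfl

theorem eqSub_snoc {Δ : Ctx T.sig m} {Γ : Ctx T.sig n} {A : Ty T.sig n}
    {σ τ : Sub T.sig (n + 1) m} :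
    T.EqSub Δ (Γ.snoc A) σ τ ↔ T.EqSub Δ Γ (fun i => σ i.succ) (fun i => τ i.succ) ∧
      T.Der Δ (.eqTm (σ 0) (τ 0) (A.sub (fun i => σ i.succ))) := by
  constructor
  · intro h
    refine ⟨fun i => ?_, ?_⟩
    · have := h i.succ
      rwa [show (Γ.snoc A).type i.succ = (Γ.type i).wk from rfl, Expr.wk_sub] at this
    · have := h 0
      rwa [show (Γ.snoc A).type 0 = A.wk from rfl, Expr.wk_sub] at this
  · rintro ⟨h, h0⟩ i
    refine Fin.cases ?_ (fun j => ?_) i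
    · rwa [show (Γ.snoc A).type 0 = A.wk from rfl, Expr.wk_sub]
    · rw [show (Γ.snoc A).type j.succ = (Γ.type j).wk from rfl, Expr.wk_sub]
      exact h j

theorem isSub_cons {Δ : Ctx T.sig m} {Γ : Ctx T.sig n} {A : Ty T.sig n} {σ : Sub T.sig n m}
    {a : Tm T.sig m} (hσ : T.IsSub Δ Γ σ) (ha : T.Der Δ (.hasTy a (A.sub σ))) :
    T.IsSub Δ (Γ.snoc A) (Sub.cons a σ) :=
  isSub_snoc.2 ⟨hσ, ha⟩

theorem isTy_sub {Δ : Ctx T.sig m} {Γ : Ctx T.sig n} {A : Ty T.sig n} {σ : Sub T.sig n m}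
    (hΔ : T.Wf Δ) (hσ : T.IsSub Δ Γ σ) (hA : T.Der Γ (.isTy A)) : T.Der Δ (.isTy (A.sub σ)) :=
  der_sub hΔ hσ hA

theorem hasTy_sub {Δ : Ctx T.sig m} {Γ : Ctx T.sig n} {A : Ty T.sig n} {a : Tm T.sig n}
    {σ : Sub T.sig n m} (hΔ : T.Wf Δ) (hσ : T.IsSub Δ Γ σ) (ha : T.Der Γ (.hasTy a A)) :
    T.Der Δ (.hasTy (a.sub σ) (A.sub σ)) :=
  der_sub hΔ hσ ha

theorem isTy_wk {Γ : Ctx T.sig n} {A B : Ty T.sig n} (hB : T.Der Γ (.isTy B))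
    (hA : T.Der Γ (.isTy A)) : T.Der (Γ.snoc A) (.isTy B.wk) := by
  rw [wk_eq_sub]; exact der_wk hB hA

/-- Substitution composed with an extended substitution. -/
theorem comp_up_cons (σ : Sub T.sig n m) (a : Tm T.sig l) (γ : Sub T.sig m l) :
    Sub.comp σ.up (Sub.cons a γ) = Sub.cons a (Sub.comp σ γ) := by
  funext i
  refine Fin.cases rfl (fun j => ?_) i
  exact Expr.wk_sub_cons (σ j) a γ

/-- The square of display maps over a context morphism is a pullback. The type `B` is `A[σ]`. -/
theorem isPullback_display {Δ : Ctx T.sig m} {Γ : Ctx T.sig n} {A : Ty T.sig n} {B : Ty T.sig m}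
    {σ : Sub T.sig n m} (hΔ : T.Wf Δ) (hΓ : T.Wf Γ) (hσ : T.IsSub Δ Γ σ)
    (hA : T.Wf (Γ.snoc A)) (hB : T.Wf (Δ.snoc B)) (hup : T.IsSub (Δ.snoc B) (Γ.snoc A) σ.up)
    (e : B = A.sub σ) :
    IsPullback (homOf hB hA σ.up hup) (display hΔ hB) (display hΓ hA) (homOf hΔ hΓ σ hσ) := by
  -- The equation is a hypothesis because the lemma is also applied to `A.wk` and to weakened
  -- identity types, which equal the substituted types only propositionally.
  subst e
  have hA' := isTy_of_wf_snoc hA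
  have w : homOf hB hA σ.up hup ≫ display hΓ hA = display hΔ hB ≫ homOf hΔ hΓ σ hσ := by
    refine (homOf_comp _ _).trans (Eq.trans (homOf_congr ?_) (homOf_comp _ _).symm)
    funext i
    exact wk_eq_sub (σ i)
  refine isPullback_of_exists_unique w ?_ ?_
  · intro W f g h
    induction W using ClassifyingCat.ind with
    | _ Ξ hΞ =>
    obtain ⟨φ, hφ, rfl⟩ := exists_homOf f
    obtain ⟨γ, hγ, rfl⟩ := exists_homOf g
    have h' : T.EqSub Ξ Γ (fun i => φ i.succ) (Sub.comp σ γ) := homOf_eq_iff.1 h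
    obtain ⟨hφ', hφ0⟩ := isSub_snoc.1 hφ
    have hσγ := isSub_comp hΞ hγ hσ
    -- The last component of `φ` is typed over the base part of `φ`, which is only definitionally
    -- equal to `σ` after `γ`; it is converted along `A` applied to that equality.
    have h0 : T.Der Ξ (.hasTy (φ 0) ((A.sub σ).sub γ)) := by
      rw [Expr.sub_sub]
      exact .tm_conv hφ0 (ty_eqSub hΞ hφ' hσγ h' hA')
    refine ⟨homOf hΞ hB (Sub.cons (φ 0) γ) (isSub_cons hγ h0), ?_, rfl⟩
    refine ((homOf_comp _ _).trans (homOf_congr (comp_up_cons σ _ γ))).trans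
      (homOf_eq_iff (hσ := isSub_cons hσγ (by rwa [← Expr.sub_sub])).2 (eqSub_snoc.2 ⟨?_, ?_⟩))
    · exact eqSub_symm hΞ hΓ hφ' hσγ h'
    · refine .tm_refl ?_
      rw [Expr.sub_sub] at h0
      exact h0
  · intro W f g h₁ h₂
    induction W using ClassifyingCat.ind with
    | _ Ξ hΞ =>
    obtain ⟨φ, hφ, rfl⟩ := exists_homOf f
    obtain ⟨γ, hγ, rfl⟩ := exists_homOf g
    -- The projection to `Δ` determines all components but the last, and the map to `[Γ, A]`
    -- determines the last.
    refine homOf_eq_iff.2 (eqSub_snoc.2 ⟨homOf_eq_iff.1 h₂, ?_⟩)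
    have h := (eqSub_snoc.1 (homOf_eq_iff.1 ((homOf_comp _ _).symm.trans
      (h₁.trans (homOf_comp _ _))))).2
    change T.Der Ξ (.eqTm (φ 0) (γ 0) ((A.sub σ).sub fun i => φ i.succ))
    rw [Expr.sub_sub]
    have e : (fun i : Fin n => Sub.comp σ.up φ i.succ) = Sub.comp σ fun i => φ i.succ := by
      funext i
      exact Expr.wk_sub (σ i) φ
    rw [e] at h
    exact h

end Homs

/-! ### Fibrations presented by a single display map -/

section Fibrations

variable {T : TypeTheory.{u}} {m n : ℕ}

theorem isSub_up_of_wf {Δ : Ctx T.sig m} {Γ : Ctx T.sig n} {A : Ty T.sig n} {B : Ty T.sig m}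
    {σ : Sub T.sig n m} (hσ : T.IsSub Δ Γ σ) (hB : T.Wf (Δ.snoc B)) (e : B = A.sub σ) :
    T.IsSub (Δ.snoc B) (Γ.snoc A) σ.up := by
  subst e
  exact isSub_up hσ (isTy_of_wf_snoc hB)

theorem wf_snoc_sub {Δ : Ctx T.sig m} {Γ : Ctx T.sig n} {A : Ty T.sig n} {σ : Sub T.sig n m}
    (hΔ : T.Wf Δ) (hσ : T.IsSub Δ Γ σ) (hA : T.Wf (Γ.snoc A)) : T.Wf (Δ.snoc (A.sub σ)) :=
  .snoc hΔ (isTy_sub hΔ hσ (isTy_of_wf_snoc hA))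

theorem isPullback_display_sub {Δ : Ctx T.sig m} {Γ : Ctx T.sig n} {A : Ty T.sig n}
    {σ : Sub T.sig n m} (hΔ : T.Wf Δ) (hΓ : T.Wf Γ) (hσ : T.IsSub Δ Γ σ)
    (hA : T.Wf (Γ.snoc A)) :
    IsPullback
      (homOf (wf_snoc_sub hΔ hσ hA) hA σ.up (isSub_up_of_wf hσ (wf_snoc_sub hΔ hσ hA) rfl))
      (display hΔ (wf_snoc_sub hΔ hσ hA)) (display hΓ hA) (homOf hΔ hΓ σ hσ) :=
  isPullback_display _ _ _ _ _ _ rfl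

/-- A presentation of a morphism as isomorphic to a display map. -/
structure DisplayRep {X I : T.ClassifyingCat} (α : X ⟶ I) where
  len : ℕ
  Γ : Ctx T.sig len
  wf : T.Wf Γ
  A : Ty T.sig len
  wf_snoc : T.Wf (Γ.snoc A)
  base : I ≅ ob Γ wf
  total : X ≅ ob (Γ.snoc A) wf_snoc
  comm : total.hom ≫ display wf wf_snoc = α ≫ base.hom

namespace DisplayRep

variable {X Y I J : T.ClassifyingCat}

theorem isPullback {α : X ⟶ I} (R : DisplayRep α) :
    IsPullback R.total.hom α (display R.wf R.wf_snoc) R.base.hom :=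
  IsPullback.of_horiz_isIso ⟨R.comm⟩

theorem total_inv_comp {α : X ⟶ I} (R : DisplayRep α) :
    R.total.inv ≫ α = display R.wf R.wf_snoc ≫ R.base.inv := by
  rw [Iso.inv_comp_eq, ← Category.assoc, R.comm, Category.assoc, Iso.hom_inv_id, Category.comp_id]

/-- Every presentation can be moved to a given context that represents the codomain. -/
theorem exists_over {Δ : Ctx T.sig m} {hΔ : T.Wf Δ} {α : X ⟶ ob Δ hΔ} (R : DisplayRep α) :
    ∃ (A : Ty T.sig m) (hA : T.Wf (Δ.snoc A)) (e : X ≅ ob (Δ.snoc A) hA),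
      e.hom ≫ display hΔ hA = α := by
  -- The isomorphism of bases is a context morphism `σ`. Both `α` and the display map of `R.A[σ]`
  -- are pullbacks of the presenting display map along it, hence isomorphic over `Δ`.
  obtain ⟨σ, hσ, h⟩ := exists_homOf R.base.hom
  have hR := R.isPullback
  rw [h] at hR
  have hD := isPullback_display_sub hΔ R.wf hσ R.wf_snoc
  exact ⟨_, _, hR.isoIsPullback _ _ hD, hR.isoIsPullback_hom_snd _ _ hD⟩

def ofIso {Δ : Ctx T.sig m} {hΔ : T.Wf Δ} {α : X ⟶ ob Δ hΔ} {A : Ty T.sig m}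
    {hA : T.Wf (Δ.snoc A)} (e : X ≅ ob (Δ.snoc A) hA) (h : e.hom ≫ display hΔ hA = α) :
    DisplayRep α :=
  ⟨_, _, hΔ, _, hA, Iso.refl _, e, by simpa using h⟩

/-- Presentations are transported along isomorphisms of morphisms. -/
def transport {α : X ⟶ I} {β : Y ⟶ J} (R : DisplayRep α) (a : Y ≅ X) (b : J ≅ I)
    (h : a.hom ≫ α = β ≫ b.hom) : DisplayRep β where
  len := R.len
  Γ := R.Γ
  wf := R.wf
  A := R.A
  wf_snoc := R.wf_snoc
  base := b ≪≫ R.base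
  total := a ≪≫ R.total
  comm := by
    rw [Iso.trans_hom, Iso.trans_hom, Category.assoc, R.comm, reassoc_of% h]

theorem fibrations {α : X ⟶ I} (R : DisplayRep α) : T.fibrations α := by
  refine ⟨_, _, display R.wf R.wf_snoc, ?_, ⟨Arrow.isoMk R.total.symm R.base.symm ?_⟩⟩
  · have := IsDepProj.display_comp R.wf R.wf_snoc _ (IsDepProj.id _)
    rwa [Category.comp_id] at this
  · exact (Iso.inv_comp_eq _).2 (by
      rw [← Category.assoc]
      exact (Iso.eq_comp_inv _).2 R.comm.symm)

/-- A pullback of a presented morphism has a presentation over any context that represents the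
new codomain. -/
theorem exists_of_isPullback {Δ : Ctx T.sig m} {hΔ : T.Wf Δ} {α : X ⟶ I} (R : DisplayRep α)
    {κ' : Y ⟶ X} {α' : Y ⟶ ob Δ hΔ} {κ : ob Δ hΔ ⟶ I} (h : IsPullback κ' α' α κ)
    {σ : Sub T.sig R.len m} (hσ : T.IsSub Δ R.Γ σ) (hκ : κ ≫ R.base.hom = homOf hΔ R.wf σ hσ) :
    ∃ e : Y ≅ ob (Δ.snoc (R.A.sub σ)) (wf_snoc_sub hΔ hσ R.wf_snoc),
      e.hom ≫ display hΔ (wf_snoc_sub hΔ hσ R.wf_snoc) = α' ∧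
      e.hom ≫ homOf (wf_snoc_sub hΔ hσ R.wf_snoc) R.wf_snoc σ.up
        (isSub_up_of_wf hσ (wf_snoc_sub hΔ hσ R.wf_snoc) rfl) = κ' ≫ R.total.hom := by
  have h' := h.paste_horiz R.isPullback
  rw [hκ] at h'
  have hD := isPullback_display_sub hΔ R.wf hσ R.wf_snoc
  exact ⟨h'.isoIsPullback _ _ hD, h'.isoIsPullback_hom_snd _ _ hD,
    h'.isoIsPullback_hom_fst _ _ hD⟩

end DisplayRep

/-! ### Strong sums and the tribe axioms -/

section StrongSums

theorem up_comp_up {l : ℕ} (σ : Sub T.sig n m) (τ : Sub T.sig m l) :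
    Sub.comp σ.up τ.up = (Sub.comp σ τ).up := upN_comp 1 σ τ

/-- The section `*` of the display map is its inverse, by the eta rule of the unit type. Identities
thereby become display maps. -/
theorem exists_iso_snoc_unit (hS : T.StrongSums) {Γ : Ctx T.sig n} (hΓ : T.Wf Γ) :
    ∃ (h : T.Wf (Γ.snoc (hS.unit n))) (e : ob Γ hΓ ≅ ob (Γ.snoc (hS.unit n)) h),
      e.hom ≫ display hΓ h = 𝟙 _ := by
  have hu := hS.unit_form hΓ
  have h : T.Wf (Γ.snoc (hS.unit n)) := .snoc hΓ hu
  have hs : T.IsSub Γ (Γ.snoc (hS.unit n)) (Sub.cons (hS.star n) (Sub.id n)) :=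
    isSub_cons (isSub_id hΓ) (by rw [Expr.sub_id]; exact hS.star_intro hΓ)
  refine ⟨h, ⟨homOf hΓ h _ hs, display hΓ h, rfl, ?_⟩, rfl⟩
  refine (homOf_comp _ _).trans (Eq.symm ((homOf_id h).symm.trans
    (homOf_eq_iff.2 (eqSub_snoc.2 ⟨eqSub_refl (isSub_proj h), ?_⟩))))
  have h0 := Derivable.ax hu
  rw [wk_eq_sub, hS.unit_sub] at h0
  have := hS.unit_eta h0
  change T.Der _ (.eqTm (.var 0) ((hS.star n).sub (Sub.proj n)) ((hS.unit n).sub (Sub.proj n)))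
  rwa [hS.unit_sub, hS.star_sub]

/-- Pairing and the two projections are mutually inverse context morphisms: the computation rules
give one composite and surjective pairing the other. -/
theorem exists_iso_snoc_Sig (hS : T.StrongSums) {Γ : Ctx T.sig n} {A : Ty T.sig n}
    {B : Ty T.sig (n + 1)} (hΓ : T.Wf Γ) (hA : T.Wf (Γ.snoc A)) (hB : T.Wf ((Γ.snoc A).snoc B)) :
    ∃ (h : T.Wf (Γ.snoc (hS.Sig A B))) (e : ob _ hB ≅ ob _ h),
      e.hom ≫ display hΓ h = display hA hB ≫ display hΓ hA := by
  have tA := isTy_of_wf_snoc hA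
  have tB := isTy_of_wf_snoc hB
  have tS := hS.Sig_form tA tB
  have h : T.Wf (Γ.snoc (hS.Sig A B)) := .snoc hΓ tS
  let p : Sub T.sig n (n + 1) := Sub.proj n
  let p₂ : Sub T.sig n (n + 2) := Sub.comp (Sub.proj n) (Sub.proj (n + 1))
  have hp : T.IsSub (Γ.snoc (hS.Sig A B)) Γ p := isSub_proj h
  have hp₂ : T.IsSub ((Γ.snoc A).snoc B) Γ p₂ := isSub_comp hB (isSub_proj hB) (isSub_proj hA)
  -- The formers carry their types as arguments, so `A` and `B` are weakened to each of the two
  -- contexts: along `p` for the projections, along `p₂` for pairing.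
  have tA₁ := isTy_sub h hp tA
  have tB₁ := isTy_sub (.snoc h tA₁) (isSub_up hp tA₁) tB
  have tA₂ := isTy_sub hB hp₂ tA
  have tB₂ := isTy_sub (.snoc hB tA₂) (isSub_up hp₂ tA₂) tB
  obtain ⟨hv', hv₀⟩ := isSub_snoc.1 (isSub_id hB)
  have hv₁ : T.Der ((Γ.snoc A).snoc B) (.hasTy (.var 1) (A.sub p₂)) := (isSub_snoc.1 hv').2
  -- Instantiating the weakened `B` at the variable `x` gives back the plain weakening of `B`, which
  -- is the type of the last variable.
  have e₁ : Sub.comp p₂.up (Sub.inst (Expr.var 1)) = Sub.proj (n + 1) := by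
    rw [Sub.up_comp_inst]; exact Sub.cons_eta (Sub.proj (n + 1))
  have hv₀' : T.Der ((Γ.snoc A).snoc B)
      (.hasTy (.var 0) ((B.sub p₂.up).sub (Sub.inst (Expr.var 1)))) := by
    rw [Expr.sub_sub, e₁]; exact hv₀
  have hc : T.Der (Γ.snoc (hS.Sig A B)) (.hasTy (.var 0) (hS.Sig (A.sub p) (B.sub p.up))) := by
    rw [← hS.Sig_sub, ← wk_eq_sub]; exact .ax tS
  have hpair := hS.pair_intro tA₂ tB₂ hv₁ hv₀'
  have hf := hS.fst_elim tA₁ tB₁ hc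
  have hs := hS.snd_elim tA₁ tB₁ hc
  rw [Expr.sub_sub, Sub.up_comp_inst] at hs
  have hσ : T.IsSub ((Γ.snoc A).snoc B) (Γ.snoc (hS.Sig A B)) (Sub.cons _ p₂) :=
    isSub_cons hp₂ (by rw [hS.Sig_sub]; exact hpair)
  have hτ : T.IsSub (Γ.snoc (hS.Sig A B)) ((Γ.snoc A).snoc B) (Sub.cons _ (Sub.cons _ p)) :=
    isSub_cons (isSub_cons hp hf) hs
  refine ⟨h, ⟨homOf hB h _ hσ, homOf h hB _ hτ, ?_, ?_⟩, rfl⟩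
  -- Equality of context morphisms is typed along its left-hand side. With the identity on the left,
  -- the types are plain weakenings and no conversion is needed.
  · refine (homOf_comp _ _).trans (Eq.symm ((homOf_id hB).symm.trans
      (homOf_eq_iff.2 (eqSub_snoc.2 ⟨eqSub_snoc.2 ⟨eqSub_refl hp₂, ?_⟩, ?_⟩))))
    · have := Derivable.tm_symm (hS.fst_pair tA₂ tB₂ hv₁ hv₀')
      change T.Der _ (.eqTm (.var 1) ((hS.fst (A.sub p) (B.sub p.up) (.var 0)).sub _) (A.sub p₂))
      rw [hS.fst_sub, Expr.sub_sub, Expr.sub_sub, up_comp_up]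
      exact this
    · have := Derivable.tm_symm (hS.snd_pair tA₂ tB₂ hv₁ hv₀')
      rw [Expr.sub_sub, e₁] at this
      change T.Der _ (.eqTm (.var 0) ((hS.snd (A.sub p) (B.sub p.up) (.var 0)).sub _)
        (B.sub (Sub.proj (n + 1))))
      rw [hS.snd_sub, Expr.sub_sub, Expr.sub_sub, up_comp_up]
      exact this
  · refine (homOf_comp _ _).trans (Eq.symm ((homOf_id h).symm.trans
      (homOf_eq_iff.2 (eqSub_snoc.2 ⟨eqSub_refl hp, ?_⟩))))
    have := Derivable.tm_symm (hS.pair_eta tA₁ tB₁ hc)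
    change T.Der _ (.eqTm (.var 0) ((hS.pair (A.sub p₂) (B.sub p₂.up) (.var 1) (.var 0)).sub _)
        ((hS.Sig A B).sub p))
    rw [hS.pair_sub, hS.Sig_sub, Expr.sub_sub, Expr.sub_sub, up_comp_up]
    exact this

variable {X Y Z : T.ClassifyingCat}

theorem nonempty_displayRep_id (hS : T.StrongSums) (X : T.ClassifyingCat) :
    Nonempty (DisplayRep (𝟙 X)) := by
  induction X using ClassifyingCat.ind with
  | _ Γ hΓ =>
  obtain ⟨h, e, he⟩ := exists_iso_snoc_unit hS hΓ
  exact ⟨DisplayRep.ofIso e he⟩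

theorem nonempty_displayRep_comp (hS : T.StrongSums) {f : X ⟶ Y} {g : Y ⟶ Z}
    (Rf : DisplayRep f) (Rg : DisplayRep g) : Nonempty (DisplayRep (f ≫ g)) := by
  -- The presentation of `f` is moved over the very context that is the total object of `Rg`, so
  -- that the two types stack and a sum can be formed.
  obtain ⟨A, hA, e, he⟩ := (Rf.transport (β := f ≫ Rg.total.hom) (Iso.refl _) Rg.total.symm
    (by simp)).exists_over
  obtain ⟨h, e', he'⟩ := exists_iso_snoc_Sig hS Rg.wf Rg.wf_snoc hA
  exact ⟨⟨_, _, Rg.wf, _, h, Rg.base, e ≪≫ e', by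
    rw [Iso.trans_hom, Category.assoc, he', reassoc_of% he, Rg.comm, Category.assoc]⟩⟩

theorem nonempty_displayRep_of_isDepProj (hS : T.StrongSums) {f : X ⟶ Y} (hf : IsDepProj f) :
    Nonempty (DisplayRep f) := by
  induction hf with
  | id X => exact nonempty_displayRep_id hS X
  | display_comp hΓ hA f hf ih =>
    exact nonempty_displayRep_comp hS (DisplayRep.ofIso (Iso.refl _) (Category.id_comp _)) ih.some

theorem nonempty_displayRep (hS : T.StrongSums) {f : X ⟶ Y} (hf : T.fibrations f) :
    Nonempty (DisplayRep f) := by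
  obtain ⟨X', Y', g, hg, ⟨e⟩⟩ := hf
  obtain ⟨R⟩ := nonempty_displayRep_of_isDepProj hS hg
  exact ⟨R.transport (Arrow.leftFunc.mapIso e.symm) (Arrow.rightFunc.mapIso e.symm) e.inv.w⟩

theorem isDepProj_to_nil : ∀ {n : ℕ} {Γ : Ctx T.sig n} (hΓ : T.Wf Γ),
    ∃ f : ob Γ hΓ ⟶ ob Ctx.nil .nil, IsDepProj f := by
  intro n Γ hΓ
  induction hΓ with
  | nil => exact ⟨_, .id _⟩
  | snoc hΓ hA ih =>
    obtain ⟨f, hf⟩ := ih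
    exact ⟨_, .display_comp hΓ (.snoc hΓ hA) f hf⟩

theorem isTerminal_nil : Nonempty (IsTerminal (ob (T := T) Ctx.nil .nil)) := by
  refine ⟨IsTerminal.ofUniqueHom (fun X => Quotient.mk _ ⟨fun i => i.elim0, ?_⟩) fun X f => ?_⟩
  · induction X using ClassifyingCat.ind with
    | _ Γ hΓ => exact fun i => i.elim0
  · induction X using ClassifyingCat.ind with
    | _ Γ hΓ =>
      obtain ⟨σ, hσ, rfl⟩ := exists_homOf f
      exact homOf_eq_iff.2 fun i => i.elim0

/-- The classifying category of a type theory with strong sums is a tribe. -/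
theorem isTribe_fibrations (hS : T.StrongSums) : IsTribe T.fibrations where
  hasTerminal := isTerminal_nil.some.hasTerminal
  iso_mem {X Y} f hf :=
    ((nonempty_displayRep_id hS X).some.transport (Iso.refl X) (asIso f).symm (by simp)).fibrations
  comp_mem f g hf hg :=
    (nonempty_displayRep_comp hS (nonempty_displayRep hS hf).some
      (nonempty_displayRep hS hg).some).some.fibrations
  toTerminal_mem {X Z} hZ f := by
    induction X using ClassifyingCat.ind with
    | _ Γ hΓ =>
    -- Any terminal object is isomorphic to the empty context, onto which every context projects.
    obtain ⟨g, hg⟩ := isDepProj_to_nil hΓ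
    obtain ⟨R⟩ := nonempty_displayRep_of_isDepProj hS hg
    exact (R.transport (Iso.refl _) (hZ.uniqueUpToIso isTerminal_nil.some)
      (isTerminal_nil.some.hom_ext _ _)).fibrations
  pullback {X' X Y} p f hp := by
    obtain ⟨R⟩ := nonempty_displayRep hS hp
    induction Y using ClassifyingCat.ind with
    | _ Δ hΔ =>
    obtain ⟨σ, hσ, h⟩ := exists_homOf (f ≫ R.base.hom)
    have hD := isPullback_display_sub hΔ R.wf hσ R.wf_snoc
    rw [← h] at hD
    -- The substituted display map is a pullback along `f ≫ R.base.hom`; cancelling the pullback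
    -- square of the presentation leaves a pullback of `p` along `f`.
    refine ⟨_, _, R.isPullback.lift _ (display hΔ (wf_snoc_sub hΔ hσ R.wf_snoc) ≫ f)
      (by rw [hD.w, Category.assoc]), IsPullback.of_right ?_ (IsPullback.lift_snd _ _ _ _)
      R.isPullback, (DisplayRep.ofIso (Iso.refl _) (Category.id_comp _)).fibrations⟩
    rwa [IsPullback.lift_fst]

end StrongSums

end Fibrations

/-! ### Identity contexts as path objects -/

section IdentityContexts

variable {T : TypeTheory.{u}} {m n : ℕ} (hId : T.PropIdTypes)

theorem hasTy_var {Γ : Ctx T.sig n} (hΓ : T.Wf Γ) (i : Fin n) :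
    T.Der Γ (.hasTy (.var i) (Γ.type i)) := by
  have h := isSub_id hΓ i
  rwa [Expr.sub_id] at h

theorem wf_snoc_wk {Γ : Ctx T.sig n} {A : Ty T.sig n} (hA : T.Wf (Γ.snoc A)) :
    T.Wf ((Γ.snoc A).snoc A.wk) :=
  .snoc hA (isTy_wk (isTy_of_wf_snoc hA) (isTy_of_wf_snoc hA))

theorem wf_idCtx {Γ : Ctx T.sig n} {A : Ty T.sig n} (hA : T.Wf (Γ.snoc A)) :
    T.Wf (hId.idCtx Γ A) := by
  have h := wf_snoc_wk hA
  exact .snoc h (hId.formation (wf_type h 1) (hasTy_var h 1) (hasTy_var h 0))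

theorem isSub_proj_up {Γ : Ctx T.sig n} {A : Ty T.sig n} (hA : T.Wf (Γ.snoc A)) :
    T.IsSub ((Γ.snoc A).snoc A.wk) (Γ.snoc A) (Sub.proj n).up :=
  isSub_up_of_wf (isSub_proj hA) (wf_snoc_wk hA) (wk_eq_sub A)

/-- The second projection `[Γ, x ∈ A, y ∈ A] → [Γ, y ∈ A]`. -/
def display₂ {Γ : Ctx T.sig n} {A : Ty T.sig n} (hA : T.Wf (Γ.snoc A)) :
    ob ((Γ.snoc A).snoc A.wk) (wf_snoc_wk hA) ⟶ ob (Γ.snoc A) hA :=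
  homOf (wf_snoc_wk hA) hA (Sub.proj n).up (isSub_proj_up hA)

/-- Weakening `A` is substitution along its own display map, so the context with two variables of
type `A` is the fibre product over `Γ`. -/
theorem isPullback_display₂ {Γ : Ctx T.sig n} {A : Ty T.sig n} (hΓ : T.Wf Γ)
    (hA : T.Wf (Γ.snoc A)) :
    IsPullback (display hA (wf_snoc_wk hA)) (display₂ hA) (display hΓ hA) (display hΓ hA) :=
  (isPullback_display hA hΓ (isSub_proj hA) hA (wf_snoc_wk hA) (isSub_proj_up hA)
    (wk_eq_sub A)).flip

/-- The projection `[Γ, x ∈ A, y ∈ A, u ∈ Id_A(x, y)] → [Γ, x ∈ A, y ∈ A]`. -/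
def idDisplay {Γ : Ctx T.sig n} {A : Ty T.sig n} (hA : T.Wf (Γ.snoc A)) :
    ob (hId.idCtx Γ A) (wf_idCtx hId hA) ⟶ ob ((Γ.snoc A).snoc A.wk) (wf_snoc_wk hA) :=
  display (wf_snoc_wk hA) (wf_idCtx hId hA)

theorem isSub_diag {Γ : Ctx T.sig n} {A : Ty T.sig n} (hA : T.Wf (Γ.snoc A)) :
    T.IsSub (Γ.snoc A) (hId.idCtx Γ A) (hId.diag A) := by
  have tA := isTy_of_wf_snoc hA
  have h0 := Derivable.ax tA
  refine isSub_cons (isSub_cons (isSub_id hA) (by rwa [Expr.sub_id])) ?_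
  have h := hId.introduction (isTy_wk tA tA) h0
  rw [hId.Id_sub, Expr.wk_sub_cons, Expr.sub_id]
  exact h

/-- The morphism `[Γ, x ∈ A] → [Γ, x ∈ A, y ∈ A, u ∈ Id_A(x, y)]` given by `x, x, r(x)`. -/
def idRefl {Γ : Ctx T.sig n} {A : Ty T.sig n} (hA : T.Wf (Γ.snoc A)) :
    ob (Γ.snoc A) hA ⟶ ob (hId.idCtx Γ A) (wf_idCtx hId hA) :=
  homOf hA (wf_idCtx hId hA) (hId.diag A) (isSub_diag hId hA)

theorem idRefl_idDisplay_display {Γ : Ctx T.sig n} {A : Ty T.sig n} (hA : T.Wf (Γ.snoc A)) :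
    idRefl hId hA ≫ idDisplay hId hA ≫ display hA (wf_snoc_wk hA) = 𝟙 _ := rfl

theorem idRefl_idDisplay_display₂ {Γ : Ctx T.sig n} {A : Ty T.sig n} (hA : T.Wf (Γ.snoc A)) :
    idRefl hId hA ≫ idDisplay hId hA ≫ display₂ hA = 𝟙 _ := by
  refine (homOf_congr (hτ := isSub_id hA) ?_).trans (homOf_id hA)
  funext i
  refine Fin.cases rfl (fun j => rfl) i

/-- The path object `[Γ, x ∈ A, y ∈ A, u ∈ Id_A(x, y)]` of a morphism that is presented as the
display map of a type `A` over `Γ`. -/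
def DisplayRep.pathFactorisation {X I : T.ClassifyingCat} {α : X ⟶ I} (R : DisplayRep α) :
    PathFactorisation T.fibrations α where
  P := ob (hId.idCtx R.Γ R.A) (wf_idCtx hId R.wf_snoc)
  r := R.total.hom ≫ idRefl hId R.wf_snoc
  s := (idDisplay hId R.wf_snoc ≫ display R.wf_snoc (wf_snoc_wk R.wf_snoc)) ≫ R.total.inv
  t := (idDisplay hId R.wf_snoc ≫ display₂ R.wf_snoc) ≫ R.total.inv
  w := by
    simp only [Category.assoc, R.total_inv_comp]
    rw [(isPullback_display₂ R.wf R.wf_snoc).w_assoc]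
  r_s := by
    have := idRefl_idDisplay_display hId R.wf_snoc
    simp only [Category.assoc, reassoc_of% this, Iso.hom_inv_id]
  r_t := by
    have := idRefl_idDisplay_display₂ hId R.wf_snoc
    simp only [Category.assoc, reassoc_of% this, Iso.hom_inv_id]
  fib {Q π₁ π₂} h := by
    have hQ : IsPullback (π₁ ≫ R.total.hom) (π₂ ≫ R.total.hom) (display R.wf R.wf_snoc)
        (display R.wf R.wf_snoc) :=
      IsPullback.of_iso h (Iso.refl Q) R.total R.total R.base (by simp) (by simp)
        R.comm.symm R.comm.symm
    have hD := isPullback_display₂ R.wf R.wf_snoc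
    -- Identifying `Q` with `[Γ, x ∈ A, y ∈ A]` turns `(s, t)` into the display map of the identity
    -- type.
    refine ((DisplayRep.ofIso (Iso.refl _) (Category.id_comp _)).transport
      (α := idDisplay hId R.wf_snoc) (Iso.refl _) (hQ.isoIsPullback _ _ hD) ?_).fibrations
    apply hD.hom_ext <;> simp

theorem Id_wk_sub (A : Ty T.sig n) (σ : Sub T.sig n m) :
    hId.Id (A.sub σ).wk.wk (.var 1) (.var 0) =
      (hId.Id A.wk.wk (.var 1) (.var 0)).sub σ.up.up := by
  rw [hId.Id_sub, Expr.sub_wk, Expr.sub_wk]; rfl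

theorem isSub_idCtx {Γ : Ctx T.sig n} {Δ : Ctx T.sig m} {A : Ty T.sig n} {σ : Sub T.sig n m}
    (hΔ : T.Wf Δ) (hσ : T.IsSub Δ Γ σ) (hA : T.Wf (Γ.snoc A)) :
    T.IsSub (hId.idCtx Δ (A.sub σ)) (hId.idCtx Γ A) σ.up.up.up := by
  have hB := wf_snoc_sub hΔ hσ hA
  exact isSub_up_of_wf (isSub_up_of_wf (isSub_up_of_wf hσ hB rfl) (wf_snoc_wk hB)
    (Expr.sub_wk A σ)) (wf_idCtx hId hB) (Id_wk_sub hId A σ)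

theorem comp_up_inst₃ (σ : Sub T.sig n m) (a b p : Tm T.sig m) :
    Sub.comp σ.up.up.up (T.inst₃ a b p) = Sub.cons p (Sub.cons b (Sub.cons a σ)) := by
  have h : Sub.comp σ (Sub.id m) = σ := funext fun i => Expr.sub_id _
  rw [inst₃, comp_up_cons, comp_up_cons, comp_up_cons, h]

/-- Naturality of `x, x, r(x)` in the ambient context; it lets the base case of an elimination be
moved along `σ`. -/
theorem comp_up_diag (A : Ty T.sig n) (σ : Sub T.sig n m) :
    Sub.comp σ.up.up.up (hId.diag (A.sub σ)) = Sub.comp (hId.diag A) σ.up := by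
  have h : Sub.comp σ.up (Sub.id (m + 1)) = σ.up := funext fun i => Expr.sub_id _
  rw [IdFormers.diag, comp_up_cons, comp_up_cons, h]
  funext i
  refine Fin.cases ?_ (fun j => Fin.cases rfl (fun j => rfl) j) i
  change _ = (hId.r A.wk (.var 0)).sub σ.up
  rw [hId.r_sub, ← Expr.sub_wk]
  rfl

/-! ### Elimination with one parameter -/

section Eliminators

variable {Γ : Ctx T.sig n} {Δ : Ctx T.sig m} {A : Ty T.sig n} {B : Ty T.sig (n + 3)}
  {C : Ty T.sig (n + 4)} {d : Tm T.sig (n + 2)} {σ : Sub T.sig n m}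

/-- The eliminator for a type `C` that depends on one more variable `z ∈ B`, after a change `σ` of
the ambient context. -/
def elimSub (A : Ty T.sig n) (B : Ty T.sig (n + 3)) (C : Ty T.sig (n + 4)) (d : Tm T.sig (n + 2))
    (σ : Sub T.sig n m) (a b p : Tm T.sig m) : Tm T.sig (m + 1) :=
  hId.J (k := 1) (A.sub σ) (.cons (B.sub σ.up.up.up) .nil) (C.sub σ.up.up.up.up) a b p
    (d.sub σ.up.up)

/-- Keeping `σ` apart from the data makes substitution act by composition on `σ`, so one eliminator
can be compared at different endpoints. -/
theorem elimSub_sub {l : ℕ} (a b p : Tm T.sig m) (τ : Sub T.sig m l) :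
    (elimSub hId A B C d σ a b p).sub τ.up =
      elimSub hId A B C d (Sub.comp σ τ) (a.sub τ) (b.sub τ) (p.sub τ) := by
  refine (hId.J_sub (k := 1) _ _ _ _ _ _ _ τ).trans ?_
  simp only [elimSub, ← up_comp_up, ← Expr.sub_sub]
  rfl

theorem isTy_elim_motive (hΔ : T.Wf Δ) (hσ : T.IsSub Δ Γ σ) (hA : T.Wf (Γ.snoc A))
    (hC : T.Der ((hId.idCtx Γ A).snoc B) (.isTy C)) :
    T.Der ((hId.idCtx Δ (A.sub σ)).snoc (B.sub σ.up.up.up)) (.isTy (C.sub σ.up.up.up.up)) := by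
  have hs := isSub_idCtx hId hΔ hσ hA
  have hw := wf_snoc_sub (wf_idCtx hId (wf_snoc_sub hΔ hσ hA)) hs (T.ctx_wf hC)
  exact isTy_sub hw (isSub_up_of_wf hs hw rfl) hC

theorem hasTy_elim_base (hΔ : T.Wf Δ) (hσ : T.IsSub Δ Γ σ) (hA : T.Wf (Γ.snoc A))
    (hd : T.Der ((Γ.snoc A).snoc (B.sub (hId.diag A))) (.hasTy d (C.sub (hId.diag A).up))) :
    T.Der ((Δ.snoc (A.sub σ)).snoc ((B.sub σ.up.up.up).sub (hId.diag (A.sub σ))))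
      (.hasTy (d.sub σ.up.up) ((C.sub σ.up.up.up.up).sub (hId.diag (A.sub σ)).up)) := by
  have hw₁ := wf_snoc_sub hΔ hσ hA
  have hs := isSub_up_of_wf hσ hw₁ rfl
  have hw := wf_snoc_sub hw₁ hs (T.ctx_wf hd)
  have h := hasTy_sub hw (isSub_up_of_wf hs hw rfl) hd
  rw [Expr.sub_sub B, ← comp_up_diag, ← Expr.sub_sub B, Expr.sub_sub C, up_comp_up,
    ← comp_up_diag, ← up_comp_up, ← Expr.sub_sub C] at h
  exact h

theorem hasTy_elimSub (hΔ : T.Wf Δ) (hσ : T.IsSub Δ Γ σ) (hA : T.Wf (Γ.snoc A))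
    (hC : T.Der ((hId.idCtx Γ A).snoc B) (.isTy C))
    (hd : T.Der ((Γ.snoc A).snoc (B.sub (hId.diag A))) (.hasTy d (C.sub (hId.diag A).up)))
    {a b p : Tm T.sig m} (ha : T.Der Δ (.hasTy a (A.sub σ))) (hb : T.Der Δ (.hasTy b (A.sub σ)))
    (hp : T.Der Δ (.hasTy p (hId.Id (A.sub σ) a b))) :
    T.Der (Δ.snoc (B.sub (Sub.cons p (Sub.cons b (Sub.cons a σ)))))
      (.hasTy (elimSub hId A B C d σ a b p)
        (C.sub (Sub.cons p (Sub.cons b (Sub.cons a σ))).up)) := by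
  have h := hId.elimination (k := 1) (Θ := .cons (B.sub σ.up.up.up) .nil)
    (isTy_elim_motive hId hΔ hσ hA hC) ha hb hp (hasTy_elim_base hId hΔ hσ hA hd)
  rw [← comp_up_inst₃, ← Expr.sub_sub, ← up_comp_up, ← Expr.sub_sub]
  exact h

theorem exists_hasTy_elimSub_refl (hΔ : T.Wf Δ) (hσ : T.IsSub Δ Γ σ) (hA : T.Wf (Γ.snoc A))
    (hC : T.Der ((hId.idCtx Γ A).snoc B) (.isTy C))
    (hd : T.Der ((Γ.snoc A).snoc (B.sub (hId.diag A))) (.hasTy d (C.sub (hId.diag A).up)))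
    {a : Tm T.sig m} (ha : T.Der Δ (.hasTy a (A.sub σ))) :
    ∃ h, T.Der (Δ.snoc (B.sub (Sub.cons (hId.r (A.sub σ) a) (Sub.cons a (Sub.cons a σ)))))
      (.hasTy h (hId.Id
        (C.sub (Sub.cons (hId.r (A.sub σ) a) (Sub.cons a (Sub.cons a σ))).up)
        (elimSub hId A B C d σ a a (hId.r (A.sub σ) a)) (d.sub (Sub.cons a σ).up))) := by
  have h := hId.computation (k := 1) (Θ := .cons (B.sub σ.up.up.up) .nil)
    (isTy_elim_motive hId hΔ hσ hA hC) ha (hasTy_elim_base hId hΔ hσ hA hd)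
  refine ⟨hId.H (k := 1) (A.sub σ) (.cons (B.sub σ.up.up.up) .nil) (C.sub σ.up.up.up.up) a
    (d.sub σ.up.up), ?_⟩
  rw [← comp_up_inst₃, ← Expr.sub_sub, ← up_comp_up, ← Expr.sub_sub, ← Sub.up_comp_inst σ a,
    ← up_comp_up σ.up, ← Expr.sub_sub d]
  exact h

/-- Elimination and computation with the universal endpoints `x, y, u` and `x, x, r(x)`. -/
theorem exists_elim (hA : T.Wf (Γ.snoc A)) (hC : T.Der ((hId.idCtx Γ A).snoc B) (.isTy C))
    (hd : T.Der ((Γ.snoc A).snoc (B.sub (hId.diag A))) (.hasTy d (C.sub (hId.diag A).up))) :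
    ∃ (j : Tm T.sig (n + 4)) (h : Tm T.sig (n + 2)),
      T.Der ((hId.idCtx Γ A).snoc B) (.hasTy j C) ∧
      T.Der ((Γ.snoc A).snoc (B.sub (hId.diag A)))
        (.hasTy h (hId.Id (C.sub (hId.diag A).up) (j.sub (hId.diag A).up) d)) := by
  have hw := wf_idCtx hId hA
  have hid := isSub_snoc.1 (isSub_snoc.1 (isSub_snoc.1 (isSub_id hw)).1).1
  have e₃ : Sub.cons (.var 0) (Sub.cons (.var 1) (Sub.cons (.var 2)
      fun i : Fin n => .var i.succ.succ.succ)) = Sub.id (S := T.sig) (n + 3) := by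
    funext i
    refine Fin.cases rfl (fun i => Fin.cases rfl (fun i => Fin.cases rfl (fun i => rfl) i) i) i
  have e₁ : Sub.cons (.var 0) (Sub.proj n) = Sub.id (S := T.sig) (n + 1) :=
    Sub.cons_eta (Sub.id (n + 1))
  have hy := (isSub_snoc.1 (isSub_snoc.1 (isSub_id hw)).1).2
  have hu := (isSub_snoc.1 (isSub_id hw)).2
  rw [Expr.wk_sub] at hy
  rw [hId.Id_sub, Expr.wk_sub, Expr.wk_sub] at hu
  have e₀ : ∀ k, (Sub.id (S := T.sig) k).up = Sub.id (k + 1) := fun k => upN_id 1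
  have ed : Sub.cons (hId.r (A.sub (Sub.proj n)) (.var 0)) (Sub.cons (.var 0)
      (Sub.cons (.var 0) (Sub.proj n))) = hId.diag A := by
    rw [e₁, ← wk_eq_sub]; rfl
  -- The ambient context is now the identity context itself, with `σ` the threefold weakening and
  -- `x, y, u` as endpoints; by `e₃` the resulting instantiation is the identity.
  have hj := hasTy_elimSub hId (σ := fun i : Fin n => .var i.succ.succ.succ) (a := .var 2)
    (b := .var 1) (p := .var 0) hw hid.1 hA hC hd hid.2 hy hu
  rw [e₃, e₀, Expr.sub_id, Expr.sub_id] at hj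
  -- Here the ambient context is `[Γ, x ∈ A]` and the endpoint is `x`, so the instantiation becomes
  -- the diagonal.
  obtain ⟨h, hh⟩ := exists_hasTy_elimSub_refl hId hA (isSub_proj hA) hA hC hd
    (a := .var 0) (by rw [← wk_eq_sub]; exact hasTy_var hA 0)
  rw [ed, e₁, e₀, Expr.sub_id, ← wk_eq_sub] at hh
  refine ⟨_, h, hj, ?_⟩
  -- The universal `j` restricted to the diagonal is the eliminator at `x, x, r(x)`, which is the
  -- term that `H` speaks about.
  rw [elimSub_sub]
  exact hh

end Eliminators

/-- The formation of identity types commutes with substitution, so three display squares, for `x`,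
`y` and `u`, can be stacked on `σ` and pasted. This is strict stability at the level of contexts. -/
theorem idDisplay_sub {Γ : Ctx T.sig n} {Δ : Ctx T.sig m} {A : Ty T.sig n} {σ : Sub T.sig n m}
    (hΔ : T.Wf Δ) (hΓ : T.Wf Γ) (hσ : T.IsSub Δ Γ σ) (hA : T.Wf (Γ.snoc A))
    (hB : T.Wf (Δ.snoc (A.sub σ))) (hup : T.IsSub (Δ.snoc (A.sub σ)) (Γ.snoc A) σ.up) :
    ∃ θ : ob (hId.idCtx Δ (A.sub σ)) (wf_idCtx hId hB) ⟶ ob (hId.idCtx Γ A) (wf_idCtx hId hA),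
      θ ≫ idDisplay hId hA ≫ display hA (wf_snoc_wk hA) =
        (idDisplay hId hB ≫ display hB (wf_snoc_wk hB)) ≫ homOf hB hA σ.up hup ∧
      θ ≫ idDisplay hId hA ≫ display₂ hA =
        (idDisplay hId hB ≫ display₂ hB) ≫ homOf hB hA σ.up hup ∧
      IsPullback θ ((idDisplay hId hB ≫ display hB (wf_snoc_wk hB)) ≫ display hΔ hB)
        ((idDisplay hId hA ≫ display hA (wf_snoc_wk hA)) ≫ display hΓ hA) (homOf hΔ hΓ σ hσ) := by
  have e₂ : (A.sub σ).wk = A.wk.sub σ.up := Expr.sub_wk A σ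
  have e₃ := Id_wk_sub hId A σ
  have hup₂ := isSub_up_of_wf hup (wf_snoc_wk hB) e₂
  have hup₃ := isSub_up_of_wf hup₂ (wf_idCtx hId hB) e₃
  have h₁ := isPullback_display hΔ hΓ hσ hA hB hup rfl
  have h₂ := isPullback_display hB hA hup (wf_snoc_wk hA) (wf_snoc_wk hB) hup₂ e₂
  have h₃ : IsPullback (homOf (wf_idCtx hId hB) (wf_idCtx hId hA) σ.up.up.up hup₃)
      (idDisplay hId hB) (idDisplay hId hA) _ :=
    isPullback_display (wf_snoc_wk hB) (wf_snoc_wk hA) hup₂ (wf_idCtx hId hA) (wf_idCtx hId hB)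
      hup₃ e₃
  have h₃₂ := h₃.paste_vert h₂
  refine ⟨_, h₃₂.w, ?_, h₃₂.paste_vert h₁⟩
  -- The second endpoint is not a composite of display maps, so its compatibility needs a separate
  -- comparison of substitutions.
  rw [h₃.w_assoc, Category.assoc]
  congr 1
  refine (homOf_comp _ _).trans (Eq.trans (homOf_congr ?_) (homOf_comp _ _).symm)
  rw [up_comp_up, up_comp_up]
  congr 1
  funext i
  exact wk_eq_sub (σ i)

end IdentityContexts

/-! ### Weak fillers, comparison and stability of path objects -/

section WeakLifting

variable {T : TypeTheory.{u}} {m n : ℕ} (hId : T.PropIdTypes)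

/-- Weak fillers for the pullback of `idRefl` along a display map against a display map. -/
theorem exists_filler {Γ : Ctx T.sig n} {A : Ty T.sig n} {B : Ty T.sig (n + 3)}
    {Ξ : Ctx T.sig m} {C : Ty T.sig m} (hA : T.Wf (Γ.snoc A))
    (hB : T.Wf ((hId.idCtx Γ A).snoc B)) (hB' : T.Wf ((Γ.snoc A).snoc (B.sub (hId.diag A))))
    (hg : T.IsSub _ _ (hId.diag A).up) (hΞ : T.Wf Ξ) (hC : T.Wf (Ξ.snoc C))
    (k : ob _ hB' ⟶ ob _ hC) (l : ob _ hB ⟶ ob _ hΞ)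
    (h : k ≫ display hΞ hC = homOf hB' hB (hId.diag A).up hg ≫ l) :
    ∃ (d : ob _ hB ⟶ ob _ hC) (H : ob _ hB' ⟶ ob _ (wf_idCtx hId hC)),
      d ≫ display hΞ hC = l ∧
      H ≫ idDisplay hId hC ≫ display hC (wf_snoc_wk hC) = homOf hB' hB (hId.diag A).up hg ≫ d ∧
      H ≫ idDisplay hId hC ≫ display₂ hC = k := by
  obtain ⟨τ, hτ, rfl⟩ := exists_homOf k
  obtain ⟨ρ, hρ, rfl⟩ := exists_homOf l
  have tC := isTy_of_wf_snoc hC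
  have hgρ := isSub_comp hB' hg hρ
  obtain ⟨hτ', hτ₀⟩ := isSub_snoc.1 hτ
  have hτρ : T.EqSub _ Ξ (fun i => τ i.succ) (Sub.comp ρ (hId.diag A).up) := homOf_eq_iff.1 h
  -- The last component of `k` is the base case of the elimination with motive `C[ρ]`, once its type
  -- is converted along the commutativity of the square.
  have hd : T.Der ((Γ.snoc A).snoc (B.sub (hId.diag A)))
      (.hasTy (τ 0) (C.sub (Sub.comp ρ (hId.diag A).up))) :=
    .tm_conv hτ₀ (ty_eqSub hB' hτ' hgρ hτρ tC)
  obtain ⟨j, p, hj, hp⟩ := exists_elim hId hA (isTy_sub hB hρ tC)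
    (by rw [Expr.sub_sub]; exact hd)
  have hj' := hasTy_sub hB' hg hj
  rw [Expr.sub_sub] at hj' hp
  have hρj := isSub_cons hρ hj
  have hρ₁ := isSub_cons hgρ hj'
  have hρ₂ : T.IsSub _ ((Ξ.snoc C).snoc C.wk) (Sub.cons (τ 0) _) :=
    isSub_cons hρ₁ (by rw [Expr.wk_sub_cons]; exact hd)
  -- The homotopy has components `j` on the diagonal, the last component of `k`, and the path from
  -- `H`, all over the base point `ρ` after the diagonal.
  have hρ₃ : T.IsSub _ (hId.idCtx Ξ C) (Sub.cons p _) := isSub_cons hρ₂ (by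
    rw [hId.Id_sub, Expr.wk_sub_cons, Expr.wk_sub_cons]; exact hp)
  refine ⟨homOf hB hC _ hρj, homOf hB' (wf_idCtx hId hC) _ hρ₃, rfl, ?_, ?_⟩
  · refine Eq.trans (b := homOf hB' hC _ hρ₁) rfl ((homOf_congr ?_).trans (homOf_comp _ _).symm)
    funext i
    refine Fin.cases rfl (fun i => rfl) i
  · have hτ'' := isSub_cons hgρ hd
    refine Eq.trans (b := homOf hB' hC _ hτ'') ?_ ?_
    · refine Eq.trans (homOf_comp hρ₃ (isSub_comp (wf_idCtx hId hC) (isSub_proj (wf_idCtx hId hC))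
        (isSub_proj_up hC))) (homOf_congr ?_)
      funext i
      refine Fin.cases rfl (fun i => rfl) i
    -- The target of the homotopy has base `ρ` after the diagonal instead of the base of `k`; these
    -- agree because the square commutes.
    · exact homOf_eq_iff.2 (eqSub_snoc.2 ⟨eqSub_symm hB' hΞ hτ' hgρ hτρ, .tm_refl hd⟩)

variable {X I Y D U V : T.ClassifyingCat} {α : X ⟶ I} {f : Y ⟶ D}

/-- Weak fillers for the pullbacks of the reflexivity map of a path object along fibrations. -/
theorem DisplayRep.exists_filler (R : DisplayRep α) (R' : DisplayRep f)
    {q : U ⟶ (R.pathFactorisation hId).P} (Rq : DisplayRep q) {g : V ⟶ U} {q' : V ⟶ X}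
    (hpb : IsPullback g q' q (R.pathFactorisation hId).r) {k : V ⟶ Y} {l : U ⟶ D}
    (h : k ≫ f = g ≫ l) :
    ∃ (d : U ⟶ Y) (H : V ⟶ (R'.pathFactorisation hId).P), d ≫ f = l ∧
      H ≫ (R'.pathFactorisation hId).s = g ≫ d ∧ H ≫ (R'.pathFactorisation hId).t = k := by
  have hA := R.wf_snoc
  -- The fibration `q` becomes the display map of a type `B` over the identity context; then `V` is
  -- the context `[Γ, x ∈ A, z ∈ B(x, x, r(x))]` up to isomorphism, and the problem is one about
  -- terms.
  obtain ⟨B, hB, eU, heU⟩ := Rq.exists_over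
  have hD := isPullback_display_sub hA (wf_idCtx hId hA) (isSub_diag hId hA) hB
  have hV : IsPullback (g ≫ eU.hom) (q' ≫ R.total.hom) (display (wf_idCtx hId hA) hB)
      (idRefl hId hA) :=
    IsPullback.of_iso hpb (Iso.refl V) eU R.total (Iso.refl _) (by simp) (by simp)
      (by rw [heU]; exact Category.comp_id _) (Category.comp_id _)
  let eV := hV.isoIsPullback _ _ hD
  have heV : eV.hom ≫ homOf _ hB _ _ = g ≫ eU.hom := hV.isoIsPullback_hom_fst _ _ hD
  obtain ⟨d, H, hd, hs, ht⟩ := TypeTheory.exists_filler hId hA hB _ _ R'.wf R'.wf_snoc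
    (eV.inv ≫ k ≫ R'.total.hom) (eU.inv ≫ l ≫ R'.base.hom) (by
      rw [Category.assoc, Category.assoc, R'.comm, reassoc_of% h, Iso.inv_comp_eq,
        reassoc_of% heV, Iso.hom_inv_id_assoc])
  have hf := R'.total_inv_comp
  refine ⟨eU.hom ≫ d ≫ R'.total.inv, eV.hom ≫ H, ?_, ?_, ?_⟩
  · rw [Category.assoc, Category.assoc, hf, reassoc_of% hd, Iso.hom_inv_id_assoc,
      Iso.hom_inv_id, Category.comp_id]
  · change (eV.hom ≫ H) ≫ (_ ≫ _) ≫ _ = _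
    simp only [Category.assoc] at hs ⊢
    rw [reassoc_of% hs, reassoc_of% heV]
  · change (eV.hom ≫ H) ≫ (_ ≫ _) ≫ _ = _
    simp only [Category.assoc] at ht ⊢
    rw [reassoc_of% ht, Iso.hom_inv_id_assoc, Iso.hom_inv_id, Category.comp_id]

/-- The path objects of two presentations of the same morphism map to each other over `A ×_I A`. -/
theorem DisplayRep.exists_comparison (hS : T.StrongSums) (R R' : DisplayRep α) :
    ∃ φ : (R.pathFactorisation hId).P ⟶ (R'.pathFactorisation hId).P,
      φ ≫ (R'.pathFactorisation hId).s = (R.pathFactorisation hId).s ∧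
      φ ≫ (R'.pathFactorisation hId).t = (R.pathFactorisation hId).t := by
  obtain ⟨Q, π₂, π₁, hQ, -⟩ := (isTribe_fibrations hS).pullback α α R.fibrations
  set P := R.pathFactorisation hId
  set P' := R'.pathFactorisation hId
  obtain ⟨Rf⟩ := nonempty_displayRep hS (P'.fib hQ)
  -- The reflexivity map is its own pullback along the identity, which is a fibration. It is filled
  -- against `(s', t')`, with `(s, t)` below and `r'` above; both ways around, the square is the
  -- diagonal.
  obtain ⟨Rq⟩ := nonempty_displayRep_id hS P.P
  obtain ⟨d, -, hd, -⟩ := R.exists_filler hId Rf Rq (g := P.r) (q' := 𝟙 X)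
    (IsPullback.of_vert_isIso ⟨by rw [Category.comp_id, Category.id_comp]⟩)
    (k := P'.r) (l := hQ.lift P.s P.t P.w)
    (hQ.hom_ext (by simp [P.r_s, P'.r_s]) (by simp [P.r_t, P'.r_t]))
  have h₁ := congrArg (· ≫ π₁) hd
  have h₂ := congrArg (· ≫ π₂) hd
  simp only [Category.assoc, IsPullback.lift_fst, IsPullback.lift_snd] at h₁ h₂
  exact ⟨d, h₁, h₂⟩

/-- Path objects are stable under pullback up to maps in both directions. -/
theorem DisplayRep.exists_stability (hS : T.StrongSums) {X' J Q : T.ClassifyingCat}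
    (R : DisplayRep α) {κ : J ⟶ I} {κ' : X' ⟶ X} {α' : X' ⟶ J} (R' : DisplayRep α')
    {e : Q ⟶ (R.pathFactorisation hId).P} {β : Q ⟶ J} {s' t' : Q ⟶ X'}
    (hX : IsPullback κ' α' α κ) (hQ : IsPullback e β ((R.pathFactorisation hId).s ≫ α) κ)
    (hs : s' ≫ κ' = e ≫ (R.pathFactorisation hId).s) (hsβ : s' ≫ α' = β)
    (ht : t' ≫ κ' = e ≫ (R.pathFactorisation hId).t) (htβ : t' ≫ α' = β) :
    (∃ φ : (R'.pathFactorisation hId).P ⟶ Q, φ ≫ s' = (R'.pathFactorisation hId).s ∧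
      φ ≫ t' = (R'.pathFactorisation hId).t) ∧
    (∃ ψ : Q ⟶ (R'.pathFactorisation hId).P, ψ ≫ (R'.pathFactorisation hId).s = s' ∧
      ψ ≫ (R'.pathFactorisation hId).t = t') := by
  -- It is enough that `Q` be the path object of some presentation of `α'`; the comparison maps then
  -- reach `R'`.
  suffices h : ∃ (R'' : DisplayRep α') (E : Q ≅ (R''.pathFactorisation hId).P),
      E.hom ≫ (R''.pathFactorisation hId).s = s' ∧
      E.hom ≫ (R''.pathFactorisation hId).t = t' by
    obtain ⟨R'', E, hEs, hEt⟩ := h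
    obtain ⟨φ, hφs, hφt⟩ := exists_comparison hId hS R' R''
    obtain ⟨ψ, hψs, hψt⟩ := exists_comparison hId hS R'' R'
    refine ⟨⟨φ ≫ E.inv, ?_, ?_⟩, ⟨E.hom ≫ ψ, ?_, ?_⟩⟩
    · rw [← hEs, Category.assoc, Iso.inv_hom_id_assoc, hφs]
    · rw [← hEt, Category.assoc, Iso.inv_hom_id_assoc, hφt]
    · rw [Category.assoc, hψs, hEs]
    · rw [Category.assoc, hψt, hEt]
  induction J using ClassifyingCat.ind with
  | _ Δ hΔ =>
  obtain ⟨σ, hσ, hκ⟩ := exists_homOf (κ ≫ R.base.hom)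
  -- The wanted presentation of `α'` is by the substituted type `R.A[σ]`, whose identity context is
  -- the pullback that `Q` also represents.
  obtain ⟨a, haα, haκ⟩ := R.exists_of_isPullback hX hσ hκ
  have hB := wf_snoc_sub hΔ hσ R.wf_snoc
  obtain ⟨θ, hθs, hθt, hθ⟩ := idDisplay_sub hId hΔ R.wf hσ R.wf_snoc hB
    (isSub_up_of_wf hσ hB rfl)
  have hα := R.total_inv_comp
  have hQ' : IsPullback e β ((idDisplay hId R.wf_snoc ≫
      display R.wf_snoc (wf_snoc_wk R.wf_snoc)) ≫ display R.wf R.wf_snoc)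
      (homOf hΔ R.wf σ hσ) := by
    refine IsPullback.of_iso hQ (Iso.refl _) (Iso.refl _) (Iso.refl _) R.base
      (by simp) (by simp) ?_ (by simpa using hκ)
    change (((_ ≫ _) ≫ R.total.inv) ≫ α) ≫ _ = 𝟙 _ ≫ _
    rw [Category.id_comp, Category.assoc, Category.assoc, reassoc_of% hα, Iso.inv_hom_id,
      Category.comp_id]
  let E := hQ'.isoIsPullback _ _ hθ
  have hE₁ : E.hom ≫ θ = e := hQ'.isoIsPullback_hom_fst _ _ hθ
  have hE₂ : E.hom ≫ (idDisplay hId hB ≫ display hB (wf_snoc_wk hB)) ≫ display hΔ hB = β :=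
    hQ'.isoIsPullback_hom_snd _ _ hθ
  have haκ' : a.inv ≫ κ' = homOf hB R.wf_snoc σ.up (isSub_up_of_wf hσ hB rfl) ≫ R.total.inv := by
    rw [Iso.inv_comp_eq, ← Category.assoc, haκ, Category.assoc, Iso.hom_inv_id, Category.comp_id]
  have haα' : a.inv ≫ α' = display hΔ hB := (Iso.inv_comp_eq _).2 haα.symm
  have hs' : s' ≫ κ' = E.hom ≫ θ ≫ (idDisplay hId R.wf_snoc ≫
      display R.wf_snoc (wf_snoc_wk R.wf_snoc)) ≫ R.total.inv := by
    rw [← Category.assoc, hE₁]; exact hs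
  have ht' : t' ≫ κ' = E.hom ≫ θ ≫ (idDisplay hId R.wf_snoc ≫ display₂ R.wf_snoc) ≫
      R.total.inv := by
    rw [← Category.assoc, hE₁]; exact ht
  -- Maps into the pullback `X'` are compared after `κ'`, where the endpoint compatibility of `θ` is
  -- used, and after `α'`, where both sides are `β`.
  have hEs : E.hom ≫ (idDisplay hId hB ≫ display hB (wf_snoc_wk hB)) ≫ a.inv = s' := by
    refine hX.hom_ext ?_ ?_
    · simp only [Category.assoc] at hθs hs' ⊢
      rw [haκ', hs', reassoc_of% hθs]
    · rw [hsβ, ← hE₂]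
      simp only [Category.assoc, haα']
  have hEt : E.hom ≫ (idDisplay hId hB ≫ display₂ hB) ≫ a.inv = t' := by
    refine hX.hom_ext ?_ ?_
    · simp only [Category.assoc] at hθt ht' ⊢
      rw [haκ', ht', reassoc_of% hθt]
    · rw [htβ, ← hE₂]
      simp only [Category.assoc, haα']
      rw [(isPullback_display₂ hΔ hB).w]
  exact ⟨.ofIso a haα, E, hEs, hEt⟩

end WeakLifting

end TypeTheory

end DTT

theorem mainTheorem7 (T : DTT.TypeTheory.{u}) (hS : T.StrongSums) (hId : T.PropIdTypes) :
    DTT.IsTribe T.fibrations ∧ DTT.HasPropositionalIdentityTypes T.fibrations := by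
  -- The path objects come from an arbitrary choice of presentation for each fibration; no coherence
  -- between these choices is needed.
  refine ⟨DTT.TypeTheory.isTribe_fibrations hS,
    fun α hα => (DTT.TypeTheory.nonempty_displayRep hS hα).some.pathFactorisation hId, ?_, ?_⟩
  · intro A I α hα U V q g q' hq hpb B D f hf k l h
    exact DTT.TypeTheory.DisplayRep.exists_filler hId _ _
      (DTT.TypeTheory.nonempty_displayRep hS hq).some hpb h
  · intro A I J A' Q α hα κ κ' α' hα' e β s' t' hA hQ hs hsβ ht htβ
    exact DTT.TypeTheory.DisplayRep.exists_stability hId hS _ _ hA hQ hs hsβ ht htβ
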